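/- Let $G=(V,E)$ be a connected, locally finite graph (loops and multiple edges are allowed), let $\Gamma$ be a subgroup of $\operatorname{Aut}(G)$ acting transitively on $V$, and let $\Delta(x,y)=|\operatorname{Stab}_y x|/|\operatorname{Stab}_x y|$ be its modular function, where $\operatorname{Stab}_x y$ is the orbit of $y$ under the stabilizer of $x$ in $\Gamma$. Assume that $\Gamma$ is nonunimodular, i.e. $\Delta\not\equiv 1$. Let $\Omega$ be the set of paths of finite length in $G$ (sequences of consecutive oriented edges from a starting vertex, with repetitions allowed), and write $|\omega|$, $\omega^-$, $\omega^+$ for the length, first and last vertex of $\omega\in\Omega$. Let $w:\Omega\to[0,\infty)$ be a *good* weight function, meaning: - $w(\gamma\omega)=w(\omega)$ for $\gamma\in\Gamma$, and $w(\omega^\leftarrow)=w(\omega)$ for the reversal $\omega^\leftarrow$ of $\omega$; - $w(\omega)=1$ if $|\omega|=0$, and $w(\omega)\ge 1$ if $|\omega|=1$; - $w(\omega\circ\eta)\le w(\omega)w(\eta)$ whenever $\omega^+=\eta^-$, with equality if moreover $\omega(i)\ne\eta(j)$ for all $i<|\omega|$ and $j>0$. Fix a root vertex $0\in V$ and let $d$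 be the graph distance. For $\lambda\in\mathbb R$, $n\ge 0$, $z\ge 0$ and $x\in V$ put $$Z_w(\lambda;n)=\sum_{\omega^-=0,\ |\omega|=n} w(\omega)\,\Delta(0,\omega^+)^\lambda,\qquad \chi_w(z,\lambda)=\sum_{n\ge 0} z^n Z_w(\lambda;n),\qquad G_w(z;x)=\sum_{\omega^-=0,\ \omega^+=x} w(\omega)\,z^{|\omega|}.$$ Let $z_{c,\lambda}$ be the radius of convergence of $z\mapsto\chi_w(z,\lambda)$, let $\mu_{c,\lambda}=z_{c,\lambda}^{-1}$ and $z_t=z_{c,1/2}$. Let $\mathbb P_{w,\lambda,n}$ be the probability measure on paths of length $n$ started at $0$ with $\mathbb P_{w,\lambda,n}(\{\omega\})=Z_w(\lambda;n)^{-1}w(\omega)\Delta(0,\omega^+)^\lambda$, and let $X_n=\omega^+$ be the endpoint of the random path. Then the following hold. 1. For every $\lambda\ne 1/2$ there exists a positive constant $C_\lambda$ such that $$\frac{z_{c,\lambda}}{z_{c,\lambda}-z}\le \chi_w(z,\lambda)\le \frac{C_\lambda z_{c,\lambda}}{z_{c,\lambda}-z}\qquad\text{and}\qquad \mu_{c,\lambda}^n\le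 Z_w(\lambda;n)\le C_\lambda\,\mu_{c,\lambda}^n$$ for every $0<z<z_{c,\lambda}$ and every $n\ge 0$. 2. For every $z\in[0,z_t)$ there exist positive constants $C_z, c_z$ such that $G_w(z;x)\le C_z e^{-c_z d(0,x)}$ for every $x\in V$. 3. For every $\lambda\ne 1/2$ there exist positive constants $c_\lambda,c'_\lambda$ such that $$\mathbb P_{w,\lambda,n}\bigl[\operatorname{sgn}(\lambda-1/2)\log\Delta(0,X_n)\ge c_\lambda n\bigr]\ge 1-e^{-c_\lambda n}\qquad\text{and}\qquad \mathbb P_{w,\lambda,n}\bigl[d(0,X_n)\ge c'_\lambda n\bigr]\ge 1-e^{-c'_\lambda n}$$ for every $n\ge 0$. -/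

import Mathlib

open scoped ENNReal NNReal

noncomputable section

/-- A graph, with loops and multiple edges allowed, given by its vertices `V` and its *oriented*
edges `E`. An oriented edge `e` goes from `tail e` to `head e` and has a reversal `rev e`.
(A loop may be its own reversal or not, so both conventions for orienting loops are covered.) -/
structure MultiGraph (V : Type*) (E : Type*) where
  tail : E → V
  head : E → V
  rev : E → E
  rev_rev : ∀ e, rev (rev e) = e
  tail_rev : ∀ e, tail (rev e) = head e

namespace MultiGraph

variable {V : Type*} {E : Type*}

theorem head_rev (G : MultiGraph V E) (e : E) : G.head (G.rev e) = G.tail e := by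
  rw [← G.tail_rev, G.rev_rev]

/-! ### Paths -/

/-- `G.IsPathFrom v l`: the list of oriented edges `l` can be traversed in order, starting
from the vertex `v`. -/
def IsPathFrom (G : MultiGraph V E) : V → List E → Prop
  | _, [] => True
  | v, e :: l => G.tail e = v ∧ G.IsPathFrom (G.head e) l

/-- The vertex reached from `v` after traversing the list of oriented edges `l`. -/
def endpointFrom (G : MultiGraph V E) : V → List E → V
  | v, [] => v
  | _, e :: l => G.endpointFrom (G.head e) l

theorem isPathFrom_append (G : MultiGraph V E) (v : V) (l m : List E) :
    G.IsPathFrom v (l ++ m) ↔ G.IsPathFrom v l ∧ G.IsPathFrom (G.endpointFrom v l) m := by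
  induction l generalizing v with
  | nil => simp [IsPathFrom, endpointFrom]
  | cons e l ih => simp [IsPathFrom, endpointFrom, ih, and_assoc]

theorem isPathFrom_reverse (G : MultiGraph V E) (v : V) (l : List E) (h : G.IsPathFrom v l) :
    G.IsPathFrom (G.endpointFrom v l) (l.map G.rev).reverse ∧
      G.endpointFrom (G.endpointFrom v l) (l.map G.rev).reverse = v := by
  have key : ∀ (u : V) (a : List E) (f : E),
      G.endpointFrom u (a ++ [f]) = G.head f := by
    intro u a f
    induction a generalizing u with
    | nil => rfl
    | cons e a ih => exact ih _
  induction l generalizing v with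
  | nil => exact ⟨trivial, rfl⟩
  | cons e l ih =>
    obtain ⟨h1, h2⟩ := h
    obtain ⟨i1, i2⟩ := ih _ h2
    simp only [List.map_cons, List.reverse_cons, endpointFrom]
    refine ⟨(G.isPathFrom_append _ _ _).2 ⟨i1, ?_, trivial⟩, ?_⟩
    · rw [i2, G.tail_rev]
    · rw [key, G.head_rev, h1]

/-- A path of finite length in `G`: a starting vertex together with the list of oriented edges
that are traversed. Vertices and edges may be repeated. -/
@[ext]
structure Path (G : MultiGraph V E) where
  /-- the first vertex -/
  first : V
  /-- the oriented edges traversed, in order -/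
  edges : List E
  isPath : G.IsPathFrom first edges

namespace Path

variable {G : MultiGraph V E}

/-- The length of a path. -/
def length (ω : G.Path) : ℕ := ω.edges.length

/-- The last vertex of a path. -/
def last (ω : G.Path) : V := G.endpointFrom ω.first ω.edges

/-- The reversal of a path. -/
def reverse (ω : G.Path) : G.Path where
  first := ω.last
  edges := (ω.edges.map G.rev).reverse
  isPath := (G.isPathFrom_reverse _ _ ω.isPath).1

/-- The concatenation of a contiguous pair of paths. -/
def comp (ω η : G.Path) (h : ω.last = η.first) : G.Path where
  first := ω.first
  edges := ω.edges ++ η.edges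
  isPath := (G.isPathFrom_append _ _ _).2 ⟨ω.isPath, by
    have := η.isPath
    rw [← h] at this
    exact this⟩

/-- Disjointness of a contiguous pair: `ω(i) ≠ η(j)` for all `i < |ω|` and all `j > 0`. The
vertices `ω(i)`, `i < |ω|`, are the tails of the edges of `ω`, and the vertices `η(j)`, `j > 0`,
are the heads of the edges of `η`. -/
def IsDisjoint (ω η : G.Path) : Prop :=
  ∀ e ∈ ω.edges, ∀ f ∈ η.edges, G.tail e ≠ G.head f

end Path

/-- Any two vertices are joined by a path. -/
def IsConnected (G : MultiGraph V E) : Prop :=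
  ∀ x y : V, ∃ ω : G.Path, ω.first = x ∧ ω.last = y

/-- Every vertex is incident to finitely many edges. -/
def IsLocallyFinite (G : MultiGraph V E) : Prop :=
  ∀ v : V, {e : E | G.tail e = v}.Finite

/-- The graph distance: the least length of a path from `x` to `y`. -/
def dist (G : MultiGraph V E) (x y : V) : ℕ :=
  sInf {n : ℕ | ∃ ω : G.Path, ω.first = x ∧ ω.last = y ∧ ω.length = n}

/-! ### Automorphisms and the modular function -/

/-- The automorphism group, as a group of pairs (permutation of the vertices, permutation of the
oriented edges) respecting tails, heads and reversal. -/
def autSubgroup (G : MultiGraph V E) : Subgroup (Equiv.Perm V × Equiv.Perm E) where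
  carrier := {γ | ∀ e, G.tail (γ.2 e) = γ.1 (G.tail e) ∧ G.head (γ.2 e) = γ.1 (G.head e) ∧
    G.rev (γ.2 e) = γ.2 (G.rev e)}
  one_mem' := fun _ => ⟨rfl, rfl, rfl⟩
  mul_mem' := by
    intro a b ha hb e
    obtain ⟨a1, a2, a3⟩ := ha (b.2 e)
    obtain ⟨b1, b2, b3⟩ := hb e
    simp only [Prod.fst_mul, Prod.snd_mul, Equiv.Perm.mul_apply]
    exact ⟨by rw [a1, b1], by rw [a2, b2], by rw [a3, b3]⟩
  inv_mem' := by
    intro a ha e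
    obtain ⟨a1, a2, a3⟩ := ha (a.2⁻¹ e)
    have h : a.2 (a.2⁻¹ e) = e := a.2.apply_symm_apply e
    rw [h] at a1 a2 a3
    refine ⟨?_, ?_, ?_⟩
    · exact (a.1.symm_apply_eq.2 a1).symm
    · exact (a.1.symm_apply_eq.2 a2).symm
    · exact (a.2.symm_apply_eq.2 a3).symm

/-- The automorphism group of `G`. -/
abbrev Aut (G : MultiGraph V E) : Type _ := G.autSubgroup

/-- The action of the automorphism group on the vertices. -/
instance (G : MultiGraph V E) : MulAction G.Aut V where
  smul γ v := γ.1.1 v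
  one_smul _ := rfl
  mul_smul _ _ _ := rfl

/-- The image of a path under an automorphism. -/
def Path.map {G : MultiGraph V E} (γ : G.Aut) (ω : G.Path) : G.Path where
  first := γ.1.1 ω.first
  edges := ω.edges.map γ.1.2
  isPath := by
    have key : ∀ (l : List E) (v : V), G.IsPathFrom v l →
        G.IsPathFrom (γ.1.1 v) (l.map γ.1.2) := by
      intro l
      induction l with
      | nil => intro _ _; trivial
      | cons e l ih =>
        intro v h
        refine ⟨?_, ?_⟩
        · rw [(γ.2 e).1, h.1]
        · have := ih _ h.2
          rw [← (γ.2 e).2.1] at this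
          exact this
    exact key _ _ ω.isPath

/-- The modular function `Δ(x, y) = |Stab_y x| / |Stab_x y|` of a group `Γ` of automorphisms,
where `Stab_x y` is the orbit of `y` under the stabilizer of `x` in `Γ`. -/
def modular {G : MultiGraph V E} (Γ : Subgroup G.Aut) (x y : V) : ℝ≥0 :=
  (Nat.card (MulAction.orbit (MulAction.stabilizer Γ y) x) : ℝ≥0) /
    (Nat.card (MulAction.orbit (MulAction.stabilizer Γ x) y) : ℝ≥0)

/-- `Γ` is unimodular if its modular function is identically one. -/
def IsUnimodular {G : MultiGraph V E} (Γ : Subgroup G.Aut) : Prop :=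
  ∀ x y : V, modular Γ x y = 1

/-! ### Weight functions -/

/-- Good weight functions: `Γ`-invariant, reversible, non-degenerate, zero-range, repulsive. -/
structure IsGood {G : MultiGraph V E} (Γ : Subgroup G.Aut) (w : G.Path → ℝ≥0) : Prop where
  invariant : ∀ γ ∈ Γ, ∀ ω : G.Path, w (ω.map γ) = w ω
  reversible : ∀ ω : G.Path, w ω.reverse = w ω
  weight_of_length_zero : ∀ ω : G.Path, ω.length = 0 → w ω = 1
  one_le_weight_of_length_one : ∀ ω : G.Path, ω.length = 1 → 1 ≤ w ω
  zeroRange : ∀ (ω η : G.Path) (h : ω.last = η.first), ω.IsDisjoint η →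
    w (ω.comp η h) = w ω * w η
  repulsive : ∀ (ω η : G.Path) (h : ω.last = η.first), w (ω.comp η h) ≤ w ω * w η

/-! ### Partition functions, susceptibility, critical parameters -/

/-- The paths of length `n` that start at `o`. -/
def pathsFrom (G : MultiGraph V E) (o : V) (n : ℕ) : Set G.Path :=
  {ω | ω.first = o ∧ ω.length = n}

variable {G : MultiGraph V E}

/-- `w(ω) Δ(o, ω⁺)^lam`. -/
def tiltedWeight (Γ : Subgroup G.Aut) (w : G.Path → ℝ≥0) (o : V) (lam : ℝ) (ω : G.Path) : ℝ≥0 :=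
  w ω * modular Γ o ω.last ^ lam

/-- The tilted partition function `Z_w(lam; n)`, the sum of `w(ω) Δ(o, ω⁺)^lam` over the paths `ω`
of length `n` started at `o`. -/
def partitionFn (Γ : Subgroup G.Aut) (w : G.Path → ℝ≥0) (o : V) (lam : ℝ) (n : ℕ) : ℝ≥0∞ :=
  ∑' ω : G.pathsFrom o n, (tiltedWeight Γ w o lam ω : ℝ≥0∞)

/-- The tilted susceptibility `χ_w(z, lam) = ∑ₙ zⁿ Z_w(lam; n)`. -/
def susceptibility (Γ : Subgroup G.Aut) (w : G.Path → ℝ≥0) (o : V) (z : ℝ≥0∞) (lam : ℝ) : ℝ≥0∞ :=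
  ∑' n : ℕ, z ^ n * partitionFn Γ w o lam n

/-- `z_{c,lam}(w)`, the radius of convergence of the power series `z ↦ χ_w(z, lam)` (whose
coefficients are non-negative). -/
def zCrit (Γ : Subgroup G.Aut) (w : G.Path → ℝ≥0) (o : V) (lam : ℝ) : ℝ≥0∞ :=
  sSup {z : ℝ≥0∞ | susceptibility Γ w o z lam < ⊤}

/-- `μ_{c,lam}(w) = z_{c,lam}(w)⁻¹`. -/
def muCrit (Γ : Subgroup G.Aut) (w : G.Path → ℝ≥0) (o : V) (lam : ℝ) : ℝ≥0∞ :=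
  (zCrit Γ w o lam)⁻¹

/-- The tiltability threshold `z_t(w) = z_{c,1/2}(w)`. -/
def zTilt (Γ : Subgroup G.Aut) (w : G.Path → ℝ≥0) (o : V) : ℝ≥0∞ :=
  zCrit Γ w o (1 / 2)

/-- The two-point function `G_w(z; x)`, the sum of `w(ω) z^|ω|` over all paths `ω` from `o` to
`x`. -/
def twoPoint (w : G.Path → ℝ≥0) (o : V) (z : ℝ≥0∞) (x : V) : ℝ≥0∞ :=
  ∑' ω : {ω : G.Path // ω.first = o ∧ ω.last = x}, (w ω.1 : ℝ≥0∞) * z ^ ω.1.length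

/-- Every set of paths is measurable. -/
instance : MeasurableSpace G.Path := ⊤

/-- The measure `ℙ_{w,lam,n}` on the paths of length `n` started at `o`, which gives the path `ω`
mass `Z_w(lam; n)⁻¹ w(ω) Δ(o, ω⁺)^lam`. -/
def tiltedMeasure (Γ : Subgroup G.Aut) (w : G.Path → ℝ≥0) (o : V) (lam : ℝ) (n : ℕ) :
    MeasureTheory.Measure G.Path :=
  MeasureTheory.Measure.sum fun ω : G.pathsFrom o n =>
    ((partitionFn Γ w o lam n)⁻¹ * (tiltedWeight Γ w o lam ω : ℝ≥0∞)) •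
      MeasureTheory.Measure.dirac (ω : G.Path)

end MultiGraph

end

/-!
Write `h(x, y) = log Δ(x, y)`, a `Γ`-invariant additive cocycle which plays the role of a height.
Sums over paths from `o` of `Γ`-invariant weights do not depend on `o`, so they are
submultiplicative under concatenation (`pathSum_le_mul`), and supermultiplicative when the
concatenated paths do not interact and can be recovered (`mul_pathSum_le`). The tilted
mass-transport principle (`tsum_mass_transport`) together with reversal of paths exchanges the tilts
`lam` and `1 - lam` (`pathSum_le_reverse`), so one may assume `lam > 1 / 2`.

Bridges, the paths that start strictly at their lowest and end at their highest level, concatenate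
without loss of weight. Hence the tilted generating function of a uniquely decomposable family of
bridges is at most one at `z = z_{c,lam}` (`pathSum_bridge_le_one`). Applied to first passages above
a level `t`, this says that untilted upward bridges of height about `t` have total weight
`O(exp (-lam t))` at `z_{c,lam}`, and by reversal downward bridges of depth about `t` have weight
`O(exp ((1 - lam) t))`. Therefore, for every `lam'` strictly between `1 - lam` and `lam`, both kinds
are summable over all heights after tilting by `lam'`.

By the decomposition of Hammersley and Welsh, a path that stays on one side of its first vertex is
an alternating concatenation of upward and downward bridges of strictly decreasing heights, so the
generating function of such paths is at most `∏ (1 + M u)`, where `M u` is the mass of the bridges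
of height `u` (`pathSum_slab_le`). The product converges as `M` is summable, and therefore
`χ(z_{c,lam}, lam')` is finite (`susceptibility_zCrit_lt_top`). Since `χ(z_{c,lam'}, lam')` is
infinite by submultiplicativity, `z_{c,lam} < z_{c,lam'}`; in particular `z_{c,lam} < z_t`
for all `lam ≠ 1 / 2`.

The three assertions follow. For the first, a path is cut at its last minimum and then at its last
maximum: the middle part is a bridge, and the two outer parts do not increase the height, so that
their tilted weight is dominated by the finite `χ(z_{c,lam}, 1 / 2)`. For the second, the two-point
function is dominated by the tail of `χ(z, 1 / 2)`, after a reversal if `Δ(o, x) < 1`. For the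
third, paths of small height have total weight at most `exp (ε n) Z(1 / 2; n)`, which is
exponentially smaller than `Z(lam; n)` because `z_{c,lam} < z_t`; for the finitely many `n` at which
the constants spoil this bound, it suffices that the height is large with positive probability.
-/

namespace MultiGraph

variable {V E : Type*} {G : MultiGraph V E} {Γ : Subgroup G.Aut} {w : G.Path → ℝ≥0}

/-! ### The modular function -/

theorem head_smul (γ : G.Aut) (e : E) : G.head (γ.1.2 e) = γ.1.1 (G.head e) := (γ.2 e).2.1

theorem tail_smul (γ : G.Aut) (e : E) : G.tail (γ.1.2 e) = γ.1.1 (G.tail e) := (γ.2 e).1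

theorem endpointFrom_map (γ : G.Aut) (l : List E) (v : V) :
    G.endpointFrom (γ.1.1 v) (l.map γ.1.2) = γ.1.1 (G.endpointFrom v l) := by
  induction l generalizing v with
  | nil => rfl
  | cons e l ih =>
    simp only [List.map_cons, endpointFrom, head_smul]
    exact ih _

theorem endpointFrom_append (v : V) (l m : List E) :
    G.endpointFrom v (l ++ m) = G.endpointFrom (G.endpointFrom v l) m := by
  induction l generalizing v with
  | nil => rfl
  | cons e l ih => exact ih _

namespace Path

@[simp] theorem first_map (γ : G.Aut) (ω : G.Path) : (ω.map γ).first = γ • ω.first := rfl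

@[simp] theorem last_map (γ : G.Aut) (ω : G.Path) : (ω.map γ).last = γ • ω.last :=
  endpointFrom_map γ ω.edges ω.first

@[simp] theorem length_map (γ : G.Aut) (ω : G.Path) : (ω.map γ).length = ω.length := by
  simp [Path.length, Path.map]

end Path

theorem finite_edgeLists (hfin : G.IsLocallyFinite) (n : ℕ) (v : V) :
    {l : List E | G.IsPathFrom v l ∧ l.length = n}.Finite := by
  induction n generalizing v with
  | zero =>
    refine (Set.finite_singleton []).subset ?_
    rintro l ⟨-, hl⟩
    exact List.length_eq_zero_iff.1 hl
  | succ n ih =>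
    refine ((hfin v).biUnion fun e _ => (ih (G.head e)).image (List.cons e)).subset ?_
    rintro l ⟨h, hl⟩
    cases l with
    | nil => simp at hl
    | cons e l =>
      simp only [Set.mem_iUnion, Set.mem_image]
      exact ⟨e, h.1, l, ⟨h.2, by simpa using hl⟩, rfl⟩

theorem finite_pathsFrom (hfin : G.IsLocallyFinite) (n : ℕ) (v : V) :
    (G.pathsFrom v n).Finite := by
  refine Set.Finite.of_finite_image (f := Path.edges) ((finite_edgeLists hfin n v).subset ?_) ?_
  · rintro _ ⟨ω, ⟨h1, h2⟩, rfl⟩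
    exact ⟨h1 ▸ ω.isPath, h2⟩
  · intro ω h ω' h' he
    exact Path.ext (h.1.trans h'.1.symm) he

theorem finite_orbit_stabilizer (hconn : G.IsConnected) (hfin : G.IsLocallyFinite) (x y : V) :
    (MulAction.orbit (MulAction.stabilizer Γ x) y).Finite := by
  obtain ⟨ω, h1, h2⟩ := hconn x y
  refine ((finite_pathsFrom hfin ω.length x).image Path.last).subset ?_
  rintro _ ⟨γ, rfl⟩
  refine ⟨ω.map γ.1.1, ⟨?_, ?_⟩, ?_⟩
  · rw [Path.first_map, h1]
    exact γ.2
  · simp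
  · rw [Path.last_map, h2]
    rfl

theorem card_orbit_pos (hconn : G.IsConnected) (hfin : G.IsLocallyFinite) (x y : V) :
    0 < Nat.card (MulAction.orbit (MulAction.stabilizer Γ x) y) := by
  have := (finite_orbit_stabilizer (Γ := Γ) hconn hfin x y).to_subtype
  have : Nonempty (MulAction.orbit (MulAction.stabilizer Γ x) y) :=
    ⟨⟨y, MulAction.mem_orbit_self y⟩⟩
  exact Nat.card_pos

theorem card_orbit_eq_relIndex (x y : V) :
    Nat.card (MulAction.orbit (MulAction.stabilizer Γ x) y) =
      (MulAction.stabilizer Γ y).relIndex (MulAction.stabilizer Γ x) := by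
  rw [Nat.card_coe_set_eq, ← MulAction.index_stabilizer, Subgroup.relIndex]
  congr 1

theorem modular_pos (hconn : G.IsConnected) (hfin : G.IsLocallyFinite) (x y : V) :
    0 < modular Γ x y := by
  have h1 := card_orbit_pos (Γ := Γ) hconn hfin x y
  have h2 := card_orbit_pos (Γ := Γ) hconn hfin y x
  unfold modular
  positivity

theorem modular_eq_relIndex_div (hconn : G.IsConnected) (hfin : G.IsLocallyFinite) (x y : V)
    (K : Subgroup Γ) (hx : K ≤ MulAction.stabilizer Γ x) (hy : K ≤ MulAction.stabilizer Γ y)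
    (hK : K.relIndex (MulAction.stabilizer Γ x) ≠ 0) :
    modular Γ x y = (K.relIndex (MulAction.stabilizer Γ y) : ℝ≥0) /
      (K.relIndex (MulAction.stabilizer Γ x) : ℝ≥0) := by
  have h1 := card_orbit_pos (Γ := Γ) hconn hfin x y
  unfold modular
  rw [card_orbit_eq_relIndex] at *
  rw [card_orbit_eq_relIndex]
  set Sx := MulAction.stabilizer Γ x
  set Sy := MulAction.stabilizer Γ y
  have e1 := Subgroup.relIndex_mul_relIndex K (Sx ⊓ Sy) Sx (le_inf hx hy) inf_le_left
  have e2 := Subgroup.relIndex_mul_relIndex K (Sx ⊓ Sy) Sy (le_inf hx hy) inf_le_right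
  rw [Subgroup.inf_relIndex_left] at e1
  rw [Subgroup.inf_relIndex_right] at e2
  have h3 : K.relIndex (Sx ⊓ Sy) ≠ 0 := by
    rw [← e1] at hK
    exact left_ne_zero_of_mul hK
  rw [← e1, ← e2]
  push_cast
  rw [mul_div_mul_left]
  exact_mod_cast h3

theorem modular_mul (hconn : G.IsConnected) (hfin : G.IsLocallyFinite) (x y z : V) :
    modular Γ x y * modular Γ y z = modular Γ x z := by
  have hne : ∀ a b : V, (MulAction.stabilizer Γ b).relIndex (MulAction.stabilizer Γ a) ≠ 0 := by
    intro a b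
    rw [← card_orbit_eq_relIndex]
    exact (card_orbit_pos hconn hfin a b).ne'
  have key : ∀ a b c : V, (MulAction.stabilizer Γ a ⊓ MulAction.stabilizer Γ b ⊓
      MulAction.stabilizer Γ c).relIndex (MulAction.stabilizer Γ a) ≠ 0 := by
    intro a b c
    refine Subgroup.relIndex_inf_ne_zero (Subgroup.relIndex_inf_ne_zero ?_ (hne a b)) (hne a c)
    simp
  set K := MulAction.stabilizer Γ x ⊓ MulAction.stabilizer Γ y ⊓ MulAction.stabilizer Γ z with hK
  have hx : K ≤ MulAction.stabilizer Γ x := inf_le_left.trans inf_le_left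
  have hy : K ≤ MulAction.stabilizer Γ y := inf_le_left.trans inf_le_right
  have hz : K ≤ MulAction.stabilizer Γ z := inf_le_right
  have kx := key x y z
  have ky : K.relIndex (MulAction.stabilizer Γ y) ≠ 0 := by
    rw [hK, inf_comm (MulAction.stabilizer Γ x)]
    exact key y x z
  rw [modular_eq_relIndex_div hconn hfin x y K hx hy kx,
    modular_eq_relIndex_div hconn hfin y z K hy hz ky,
    modular_eq_relIndex_div hconn hfin x z K hx hz kx]
  have ky' : (K.relIndex (MulAction.stabilizer Γ y) : ℝ≥0) ≠ 0 := by exact_mod_cast ky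
  rw [mul_comm, div_mul_div_cancel₀ ky']

theorem modular_self (hconn : G.IsConnected) (hfin : G.IsLocallyFinite) (x : V) :
    modular Γ x x = 1 := by
  have h := modular_mul (Γ := Γ) hconn hfin x x x
  have h' := modular_pos (Γ := Γ) hconn hfin x x
  exact (mul_eq_left₀ h'.ne').1 h

theorem modular_swap (hconn : G.IsConnected) (hfin : G.IsLocallyFinite) (x y : V) :
    modular Γ y x = (modular Γ x y)⁻¹ := by
  refine eq_inv_of_mul_eq_one_left ?_
  rw [modular_mul hconn hfin, modular_self hconn hfin]

theorem card_orbit_smul (γ : Γ) (x y : V) :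
    Nat.card (MulAction.orbit (MulAction.stabilizer Γ (γ • x)) (γ • y)) =
      Nat.card (MulAction.orbit (MulAction.stabilizer Γ x) y) := by
  have : MulAction.orbit (MulAction.stabilizer Γ (γ • x)) (γ • y) =
      (fun v => γ • v) '' MulAction.orbit (MulAction.stabilizer Γ x) y := by
    ext v
    constructor
    · rintro ⟨⟨g, hg⟩, rfl⟩
      refine ⟨γ⁻¹ • g • γ • y, ⟨⟨γ⁻¹ * g * γ, ?_⟩, ?_⟩, ?_⟩
      · rw [MulAction.mem_stabilizer_iff] at hg ⊢
        rw [mul_smul, mul_smul, hg, inv_smul_smul]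
      · simp [Subgroup.smul_def, mul_smul]
      · simp [Subgroup.smul_def]
    · rintro ⟨_, ⟨⟨g, hg⟩, rfl⟩, rfl⟩
      refine ⟨⟨γ * g * γ⁻¹, ?_⟩, ?_⟩
      · rw [MulAction.mem_stabilizer_iff] at hg ⊢
        rw [mul_smul, mul_smul, inv_smul_smul, hg]
      · simp [Subgroup.smul_def, mul_smul]
  rw [this, Nat.card_image_of_injective (MulAction.injective γ)]

theorem modular_smul (γ : Γ) (x y : V) : modular Γ (γ • x) (γ • y) = modular Γ x y := by
  unfold modular
  rw [card_orbit_smul, card_orbit_smul]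

/-- The tilted mass-transport principle: a diagonally invariant mass transport sends from `o` the
mass that `o` receives, each contribution from `y` being weighted by `Δ(o, y)`. -/
theorem tsum_mass_transport (hconn : G.IsConnected) (hfin : G.IsLocallyFinite)
    (htrans : MulAction.IsPretransitive Γ V) (F : V → V → ℝ≥0∞)
    (hF : ∀ (γ : Γ) x y, F (γ • x) (γ • y) = F x y) (o : V) :
    ∑' y, F o y = ∑' y, F y o * (modular Γ o y : ℝ≥0∞) := by
  -- Both sums are split according to the `Γ`-orbit of the ordered pair.
  let Q := MulAction.orbitRel.Quotient Γ (V × V)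
  let f : V → Q := fun y => Quotient.mk'' (o, y)
  let g : V → Q := fun y => Quotient.mk'' (y, o)
  rw [← (Equiv.sigmaFiberEquiv f).tsum_eq, ← (Equiv.sigmaFiberEquiv g).tsum_eq,
    ENNReal.tsum_sigma', ENNReal.tsum_sigma']
  refine tsum_congr fun q => ?_
  obtain ⟨⟨a, b'⟩, rfl⟩ := Quotient.exists_rep q
  obtain ⟨γ₀, rfl⟩ := MulAction.exists_smul_eq Γ o a
  obtain ⟨b, rfl⟩ : ∃ b, γ₀ • b = b' := ⟨γ₀⁻¹ • b', smul_inv_smul _ _⟩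
  obtain ⟨γ, hγ⟩ := MulAction.exists_smul_eq Γ b o
  have hq : (⟦(γ₀ • o, γ₀ • b)⟧ : Q) = Quotient.mk'' (o, b) := Quotient.sound ⟨γ₀, rfl⟩
  have hq' : (Quotient.mk'' (o, b) : Q) = Quotient.mk'' (γ • o, o) :=
    Quotient.sound ⟨γ⁻¹, by simp [← hγ]⟩
  have hf : ∀ y, f y = ⟦(γ₀ • o, γ₀ • b)⟧ ↔
      y ∈ MulAction.orbit (MulAction.stabilizer Γ o) b := by
    intro y
    rw [hq]
    refine Quotient.eq''.trans ?_
    constructor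
    · rintro ⟨g, hg⟩
      have hg' := Prod.ext_iff.1 hg
      exact ⟨⟨g, hg'.1⟩, hg'.2⟩
    · rintro ⟨⟨g, hg⟩, rfl⟩
      exact ⟨g, Prod.ext hg rfl⟩
  have hg : ∀ y, g y = ⟦(γ₀ • o, γ₀ • b)⟧ ↔
      y ∈ MulAction.orbit (MulAction.stabilizer Γ o) (γ • o) := by
    intro y
    rw [hq, hq']
    refine Quotient.eq''.trans ?_
    constructor
    · rintro ⟨g, hg⟩
      have hg' := Prod.ext_iff.1 hg
      exact ⟨⟨g, hg'.2⟩, hg'.1⟩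
    · rintro ⟨⟨g, hg⟩, rfl⟩
      exact ⟨g, Prod.ext rfl hg⟩
  have e1 : ∀ y : {y // f y = ⟦(γ₀ • o, γ₀ • b)⟧}, F o y = F o b := by
    rintro ⟨y, hy⟩
    obtain ⟨⟨g, hg⟩, rfl⟩ := (hf y).1 hy
    have hgo : g • o = o := hg
    have h := hF g o b
    rwa [hgo] at h
  have e2 : ∀ y : {y // g y = ⟦(γ₀ • o, γ₀ • b)⟧}, F y o * (modular Γ o y : ℝ≥0∞) =
      F o b * (modular Γ o (γ • o) : ℝ≥0∞) := by
    rintro ⟨y, hy⟩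
    obtain ⟨⟨g, hg⟩, rfl⟩ := (hg y).1 hy
    have hg' : g • o = o := hg
    have h1 : F (g • γ • o) o = F o b := by
      have h := hF g (γ • o) o
      have h' := hF γ o b
      rw [hg'] at h
      rw [hγ] at h'
      exact h.trans h'
    have h2 : modular Γ o (g • γ • o) = modular Γ o (γ • o) := by
      have h := modular_smul g o (γ • o)
      rwa [hg'] at h
    exact congrArg₂ (· * ·) h1 (congrArg _ h2)
  simp only [Equiv.sigmaFiberEquiv_apply]
  rw [tsum_congr e1, tsum_congr e2, ENNReal.tsum_const, ENNReal.tsum_const,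
    ENat.card_congr (Equiv.subtypeEquivRight hf), ENat.card_congr (Equiv.subtypeEquivRight hg)]
  have : Finite (MulAction.orbit (MulAction.stabilizer Γ o) b) :=
    (finite_orbit_stabilizer hconn hfin o b).to_subtype
  have : Finite (MulAction.orbit (MulAction.stabilizer Γ o) (γ • o)) :=
    (finite_orbit_stabilizer hconn hfin o _).to_subtype
  have c1 : Nat.card (MulAction.orbit (MulAction.stabilizer Γ (γ • o)) o) =
      Nat.card (MulAction.orbit (MulAction.stabilizer Γ o) b) := by
    have := card_orbit_smul γ o b
    rwa [hγ] at this
  have c2 := card_orbit_pos (Γ := Γ) hconn hfin o (γ • o)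
  have key : (Nat.card (MulAction.orbit (MulAction.stabilizer Γ o) b) : ℝ≥0∞) =
      (Nat.card (MulAction.orbit (MulAction.stabilizer Γ o) (γ • o)) : ℝ≥0∞) *
        (modular Γ o (γ • o) : ℝ≥0∞) := by
    have : (Nat.card (MulAction.orbit (MulAction.stabilizer Γ o) b) : ℝ≥0) =
      (Nat.card (MulAction.orbit (MulAction.stabilizer Γ o) (γ • o)) : ℝ≥0) *
        modular Γ o (γ • o) := by
      unfold modular
      rw [c1, mul_div_cancel₀]
      exact_mod_cast c2.ne'
    exact_mod_cast congrArg (fun x : ℝ≥0 => (x : ℝ≥0∞)) this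
  rw [ENat.card_eq_coe_natCard, ENat.card_eq_coe_natCard, ENat.toENNReal_coe, ENat.toENNReal_coe,
    key]
  ring

/-! ### Manipulation of paths -/

namespace Path

@[simp] theorem first_comp (α β : G.Path) (h : α.last = β.first) : (α.comp β h).first = α.first :=
  rfl

@[simp] theorem edges_comp (α β : G.Path) (h : α.last = β.first) :
    (α.comp β h).edges = α.edges ++ β.edges := rfl

@[simp] theorem last_comp (α β : G.Path) (h : α.last = β.first) : (α.comp β h).last = β.last := by
  unfold Path.last
  rw [edges_comp, first_comp, endpointFrom_append, ← h]
  rfl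

@[simp] theorem length_comp (α β : G.Path) (h : α.last = β.first) :
    (α.comp β h).length = α.length + β.length := by
  simp [Path.length]

@[simp] theorem first_reverse (ω : G.Path) : ω.reverse.first = ω.last := rfl

@[simp] theorem last_reverse (ω : G.Path) : ω.reverse.last = ω.first :=
  (G.isPathFrom_reverse _ _ ω.isPath).2

@[simp] theorem length_reverse (ω : G.Path) : ω.reverse.length = ω.length := by
  simp [Path.length, Path.reverse]

@[simp] theorem reverse_reverse (ω : G.Path) : ω.reverse.reverse = ω := by
  refine Path.ext (last_reverse ω) ?_
  simp [Path.reverse, Function.comp_def, G.rev_rev]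

@[simp] theorem edges_map (γ : G.Aut) (ω : G.Path) : (ω.map γ).edges = ω.edges.map γ.1.2 := rfl

theorem map_inv_map (γ : G.Aut) (ω : G.Path) : (ω.map γ).map γ⁻¹ = ω := by
  refine Path.ext (inv_smul_smul γ ω.first) ?_
  simp only [edges_map, List.map_map]
  have : (γ⁻¹).1.2 ∘ γ.1.2 = id := by
    funext e
    exact γ.1.2.symm_apply_apply e
  rw [this, List.map_id]

theorem map_injective (γ : G.Aut) : Function.Injective (Path.map γ) :=
  Function.LeftInverse.injective (g := Path.map γ⁻¹) (map_inv_map γ)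

theorem reverse_injective : Function.Injective (Path.reverse (G := G)) :=
  Function.LeftInverse.injective (g := Path.reverse) reverse_reverse

/-- The path of length zero at `x`. -/
def trivial (x : V) : G.Path := ⟨x, [], True.intro⟩

/-- The path of length one that traverses the edge `e`. -/
def single (e : E) : G.Path := ⟨G.tail e, [e], rfl, True.intro⟩

@[simp] theorem first_single (e : E) : (single e : G.Path).first = G.tail e := rfl

@[simp] theorem last_single (e : E) : (single e : G.Path).last = G.head e := rfl

@[simp] theorem edges_single (e : E) : (single e : G.Path).edges = [e] := rfl

@[simp] theorem length_single (e : E) : (single e : G.Path).length = 1 := rfl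

theorem eq_trivial {ω : G.Path} (h : ω.length = 0) : ω = trivial ω.first :=
  Path.ext rfl (List.length_eq_zero_iff.1 h)

theorem last_eq_first {ω : G.Path} (h : ω.length = 0) : ω.last = ω.first := by
  rw [eq_trivial h]
  rfl

/-- A factorization of the list of edges lifts to a factorization of the path. -/
theorem exists_comp (ω : G.Path) (a b : List E) (h : ω.edges = a ++ b) :
    ∃ (α β : G.Path) (hab : α.last = β.first), ω = α.comp β hab ∧ α.first = ω.first ∧
      α.edges = a ∧ β.edges = b := by
  have hp := ω.isPath
  rw [h, isPathFrom_append] at hp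
  exact ⟨⟨ω.first, a, hp.1⟩, ⟨_, b, hp.2⟩, rfl, Path.ext rfl h, rfl, rfl, rfl⟩

theorem exists_comp_length (ω : G.Path) {n m : ℕ} (h : ω.length = n + m) :
    ∃ (α β : G.Path) (hab : α.last = β.first), ω = α.comp β hab ∧ α.length = n ∧
      β.length = m := by
  obtain ⟨α, β, hab, e, -, ha, hb⟩ :=
    ω.exists_comp (ω.edges.take n) (ω.edges.drop n) (List.take_append_drop n _).symm
  have h' : ω.edges.length = n + m := h
  refine ⟨α, β, hab, e, ?_, ?_⟩
  · simp [Path.length, ha, h']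
  · simp [Path.length, hb, h']

end Path

/-! ### Sums over paths -/

/-- The sum of the weights `W ω` over the paths `ω ∈ S` that start at `o`. -/
noncomputable def pathSum (W : G.Path → ℝ≥0∞) (o : V) (S : Set G.Path) : ℝ≥0∞ :=
  ∑' ω : ↥({ω : G.Path | ω.first = o} ∩ S), W ω

/-- A set of paths that is mapped to itself by every element of `Γ`. -/
def IsInvariantSet (Γ : Subgroup G.Aut) (S : Set G.Path) : Prop :=
  ∀ (γ : Γ), ∀ ω ∈ S, ω.map γ.1 ∈ S

/-- A weight that is constant on the `Γ`-orbits of paths. -/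
def IsInvariantWeight (Γ : Subgroup G.Aut) (W : G.Path → ℝ≥0∞) : Prop :=
  ∀ (γ : Γ) (ω : G.Path), W (ω.map γ.1) = W ω

/-- A weight that is submultiplicative under concatenation. -/
def IsRepulsiveWeight (W : G.Path → ℝ≥0∞) : Prop :=
  ∀ (α β : G.Path) (h : α.last = β.first), W (α.comp β h) ≤ W α * W β

theorem pathSum_mono_set (W : G.Path → ℝ≥0∞) (o : V) {S T : Set G.Path} (h : S ⊆ T) :
    pathSum W o S ≤ pathSum W o T :=
  ENNReal.tsum_mono_subtype _ (Set.inter_subset_inter_right _ h)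

theorem pathSum_le_of_injective {W W' : G.Path → ℝ≥0∞} {x x' : V} {S S' : Set G.Path}
    (φ : G.Path → G.Path) (hφ : Function.Injective φ)
    (h : ∀ ω, ω.first = x → ω ∈ S → (φ ω).first = x' ∧ φ ω ∈ S' ∧ W ω ≤ W' (φ ω)) :
    pathSum W x S ≤ pathSum W' x' S' := by
  let f : ↥({ω : G.Path | ω.first = x} ∩ S) → ↥({ω : G.Path | ω.first = x'} ∩ S') :=
    fun ω => ⟨φ ω, (h ω ω.2.1 ω.2.2).1, (h ω ω.2.1 ω.2.2).2.1⟩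
  have hf : Function.Injective f := fun a b hab =>
    Subtype.ext (hφ (congrArg Subtype.val hab))
  calc pathSum W x S ≤ ∑' ω, W' (f ω) := ENNReal.tsum_le_tsum fun ω => (h ω ω.2.1 ω.2.2).2.2
    _ ≤ pathSum W' x' S' := ENNReal.tsum_comp_le_tsum_of_injective hf _

theorem pathSum_mono {W W' : G.Path → ℝ≥0∞} {o : V} {S : Set G.Path}
    (h : ∀ ω, ω.first = o → ω ∈ S → W ω ≤ W' ω) : pathSum W o S ≤ pathSum W' o S :=
  pathSum_le_of_injective id Function.injective_id fun ω h1 h2 => ⟨h1, h2, h ω h1 h2⟩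

theorem pathSum_const_mul (W : G.Path → ℝ≥0∞) (c : ℝ≥0∞) (o : V) (S : Set G.Path) :
    pathSum (fun ω => c * W ω) o S = c * pathSum W o S :=
  ENNReal.tsum_mul_left

theorem pathSum_smul {W : G.Path → ℝ≥0∞} (hW : IsInvariantWeight Γ W) {S : Set G.Path}
    (hS : IsInvariantSet Γ S) (γ : Γ) (x : V) : pathSum W (γ • x) S = pathSum W x S := by
  have key : ∀ (γ : Γ) (x : V), pathSum W x S ≤ pathSum W (γ • x) S := fun γ x =>
    pathSum_le_of_injective (Path.map γ.1) (Path.map_injective _) fun ω h1 h2 =>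
      ⟨by rw [Path.first_map, h1]; rfl, hS γ ω h2, (hW γ ω).ge⟩
  refine le_antisymm ?_ (key γ x)
  have := key γ⁻¹ (γ • x)
  rwa [inv_smul_smul] at this

theorem pathSum_base (htrans : MulAction.IsPretransitive Γ V) {W : G.Path → ℝ≥0∞}
    (hW : IsInvariantWeight Γ W) {S : Set G.Path} (hS : IsInvariantSet Γ S) (x y : V) :
    pathSum W x S = pathSum W y S := by
  obtain ⟨γ, rfl⟩ := MulAction.exists_smul_eq Γ y x
  exact pathSum_smul hW hS γ y

theorem pathSum_iUnion_le {ι : Type*} (W : G.Path → ℝ≥0∞) (o : V) {S : Set G.Path}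
    (R : ι → Set G.Path) (h : ∀ ω, ω.first = o → ω ∈ S → ∃ i, ω ∈ R i) :
    pathSum W o S ≤ ∑' i, pathSum W o (R i) := by
  have hsub : {ω : G.Path | ω.first = o} ∩ S ⊆ ⋃ i, ({ω : G.Path | ω.first = o} ∩ R i) := by
    rintro ω ⟨h1, h2⟩
    obtain ⟨i, hi⟩ := h ω h1 h2
    exact Set.mem_iUnion.2 ⟨i, h1, hi⟩
  exact (ENNReal.tsum_mono_subtype _ hsub).trans (ENNReal.tsum_iUnion_le_tsum _ _)

theorem pathSum_prod_eq (htrans : MulAction.IsPretransitive Γ V) {W : G.Path → ℝ≥0∞}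
    (hW : IsInvariantWeight Γ W) {A B : Set G.Path} (hB : IsInvariantSet Γ B) (o : V) :
    pathSum W o A * pathSum W o B =
      ∑' p : (Σ α : ↥({ω : G.Path | ω.first = o} ∩ A), ↥({ω : G.Path | ω.first = α.1.last} ∩ B)),
        W p.1 * W p.2 := by
  rw [ENNReal.tsum_sigma']
  simp only [ENNReal.tsum_mul_left]
  rw [pathSum, ← ENNReal.tsum_mul_right]
  refine tsum_congr fun α => ?_
  rw [pathSum_base htrans hW hB o α.1.last]
  rfl

/-- If every path of `S` is a concatenation of a path of `A` and one of `B`, then the generating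
function of `S` is at most the product of those of `A` and `B`. -/
theorem pathSum_le_mul (htrans : MulAction.IsPretransitive Γ V) {W : G.Path → ℝ≥0∞}
    (hW : IsInvariantWeight Γ W) (hW' : IsRepulsiveWeight W) {S A B : Set G.Path}
    (hB : IsInvariantSet Γ B) (o : V)
    (h : ∀ ω, ω.first = o → ω ∈ S →
      ∃ (α β : G.Path) (hab : α.last = β.first), ω = α.comp β hab ∧ α ∈ A ∧ β ∈ B) :
    pathSum W o S ≤ pathSum W o A * pathSum W o B := by
  rw [pathSum_prod_eq htrans hW hB]
  choose α β hab hω hA hBm using h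
  let f : ↥({ω : G.Path | ω.first = o} ∩ S) →
      Σ α : ↥({ω : G.Path | ω.first = o} ∩ A), ↥({ω : G.Path | ω.first = α.1.last} ∩ B) :=
    fun ω => ⟨⟨α ω.1 ω.2.1 ω.2.2, (congrArg Path.first (hω ω.1 ω.2.1 ω.2.2)).symm.trans ω.2.1,
        hA ω.1 ω.2.1 ω.2.2⟩,
      ⟨β ω.1 ω.2.1 ω.2.2, (hab ω.1 ω.2.1 ω.2.2).symm, hBm ω.1 ω.2.1 ω.2.2⟩⟩
  -- A left inverse of `f` on underlying paths.
  let g : (Σ α : ↥({ω : G.Path | ω.first = o} ∩ A), ↥({ω : G.Path | ω.first = α.1.last} ∩ B)) →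
      G.Path := fun p => p.1.1.comp p.2.1 p.2.2.1.symm
  have hgf : ∀ ω, g (f ω) = ω.1 := fun ω => (hω ω.1 ω.2.1 ω.2.2).symm
  have hf : Function.Injective f := fun a b e =>
    Subtype.ext (by rw [← hgf a, ← hgf b, e])
  calc pathSum W o S ≤ ∑' ω, (W (f ω).1 * W (f ω).2) := by
        refine ENNReal.tsum_le_tsum fun ω => ?_
        conv_lhs => rw [hω ω.1 ω.2.1 ω.2.2]
        exact hW' _ _ _
    _ ≤ _ := ENNReal.tsum_comp_le_tsum_of_injective hf
        (fun p : (Σ α : ↥({ω : G.Path | ω.first = o} ∩ A),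
          ↥({ω : G.Path | ω.first = α.1.last} ∩ B)) => W p.1 * W p.2)

/-- If paths of `A` and `B` can be concatenated within `S` without loss of weight, and the first
factor can be recovered, then the generating function of `S` is at least the product of those
of `A` and `B`. -/
theorem mul_pathSum_le (htrans : MulAction.IsPretransitive Γ V) {W : G.Path → ℝ≥0∞}
    (hW : IsInvariantWeight Γ W) {S A B : Set G.Path} (hB : IsInvariantSet Γ B) (o : V)
    (h : ∀ (α β : G.Path) (hab : α.last = β.first), α ∈ A → β ∈ B →
      α.comp β hab ∈ S ∧ W α * W β ≤ W (α.comp β hab))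
    (hinj : ∀ α α' β β' : G.Path, α ∈ A → α' ∈ A → β ∈ B → β' ∈ B → α.first = α'.first →
      α.last = β.first → α'.last = β'.first → α.edges ++ β.edges = α'.edges ++ β'.edges →
      α.edges.length = α'.edges.length) :
    pathSum W o A * pathSum W o B ≤ pathSum W o S := by
  rw [pathSum_prod_eq htrans hW hB]
  let f : (Σ α : ↥({ω : G.Path | ω.first = o} ∩ A), ↥({ω : G.Path | ω.first = α.1.last} ∩ B)) →
      ↥({ω : G.Path | ω.first = o} ∩ S) := fun p =>
    ⟨p.1.1.comp p.2.1 p.2.2.1.symm, p.1.2.1, (h _ _ _ p.1.2.2 p.2.2.2).1⟩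
  have hf : Function.Injective f := by
    rintro ⟨⟨α, h1, h2⟩, ⟨β, h3, h4⟩⟩ ⟨⟨α', h1', h2'⟩, ⟨β', h3', h4'⟩⟩ e
    have e' : α.edges ++ β.edges = α'.edges ++ β'.edges :=
      congrArg Path.edges (congrArg Subtype.val e)
    have hfirst : α.first = α'.first := Eq.trans h1 (Eq.symm h1')
    have hl := hinj α α' β β' h2 h2' h4 h4' hfirst (Eq.symm h3) (Eq.symm h3') e'
    obtain ⟨ea, eb⟩ := List.append_inj e' hl
    obtain rfl : α = α' := Path.ext hfirst ea
    obtain rfl : β = β' := Path.ext (Eq.trans h3 (Eq.symm h3')) eb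
    rfl
  calc _ ≤ ∑' p, W (f p) :=
        ENNReal.tsum_le_tsum fun p => (h _ _ p.2.2.1.symm p.1.2.2 p.2.2.2).2
    _ ≤ pathSum W o S := ENNReal.tsum_comp_le_tsum_of_injective hf
      (fun ω : ↥({ω : G.Path | ω.first = o} ∩ S) => W ω)

theorem pathSum_eq_tsum_fiber {κ : Type*} (W : G.Path → ℝ≥0∞) (o : V) (S : Set G.Path)
    (f : G.Path → κ) : pathSum W o S = ∑' y, pathSum W o (S ∩ {ω | f ω = y}) := by
  classical
  simp only [pathSum, tsum_subtype]
  rw [ENNReal.tsum_comm]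
  refine tsum_congr fun ω => ?_
  rw [tsum_eq_single (f ω)]
  · simp [Set.indicator_apply]
  · intro y hy
    exact Set.indicator_of_notMem (fun h => hy h.2.2.symm) _

/-! ### Heights -/

/-- An additive cocycle on the vertices that is invariant under the diagonal action of `Γ`;
`h x y` is the height of `y` seen from `x`. -/
structure IsHeight (Γ : Subgroup G.Aut) (h : V → V → ℝ) : Prop where
  add : ∀ x y z, h x y + h y z = h x z
  smul : ∀ (γ : Γ) x y, h (γ • x) (γ • y) = h x y

namespace IsHeight

theorem neg {h : V → V → ℝ} (hh : IsHeight Γ h) : IsHeight Γ (-h) where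
  add x y z := by
    simp only [Pi.neg_apply]
    linarith [hh.add x y z]
  smul γ x y := by simp [hh.smul γ x y]

theorem self {h : V → V → ℝ} (hh : IsHeight Γ h) (x : V) : h x x = 0 := by linarith [hh.add x x x]

theorem swap {h : V → V → ℝ} (hh : IsHeight Γ h) (x y : V) : h y x = -h x y := by
  linarith [hh.add x y x, hh.self x]

end IsHeight

/-- The paths that stay strictly above their first vertex. -/
def strictlyAbove (h : V → V → ℝ) : Set G.Path :=
  {ω | ∀ e ∈ ω.edges, 0 < h ω.first (G.head e)}

/-- The paths that never go below their first vertex. -/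
def weaklyAbove (h : V → V → ℝ) : Set G.Path :=
  {ω | ∀ e ∈ ω.edges, 0 ≤ h ω.first (G.head e)}

/-- The paths that end at their maximal height. -/
def endsAtTop (h : V → V → ℝ) : Set G.Path :=
  {ω | ∀ e ∈ ω.edges, 0 ≤ h (G.tail e) ω.last}

namespace IsHeight

theorem map_head {h : V → V → ℝ} (hh : IsHeight Γ h) (γ : Γ) (x : V) (e : E) :
    h (γ.1 • x) (G.head (γ.1.1.2 e)) = h x (G.head e) := by
  rw [head_smul]
  exact hh.smul γ x _

theorem map_tail {h : V → V → ℝ} (hh : IsHeight Γ h) (γ : Γ) (x : V) (e : E) :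
    h (G.tail (γ.1.1.2 e)) (γ.1 • x) = h (G.tail e) x := by
  rw [tail_smul]
  exact hh.smul γ _ x

theorem map_tail' {h : V → V → ℝ} (hh : IsHeight Γ h) (γ : Γ) (x : V) (e : E) :
    h (γ.1 • x) (G.tail (γ.1.1.2 e)) = h x (G.tail e) := by
  rw [tail_smul]
  exact hh.smul γ x _

theorem map_first_last {h : V → V → ℝ} (hh : IsHeight Γ h) (γ : Γ) (ω : G.Path) :
    h (ω.map γ.1).first (ω.map γ.1).last = h ω.first ω.last := by
  rw [Path.first_map, Path.last_map]
  exact hh.smul γ _ _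

end IsHeight

theorem isInvariantSet_strictlyAbove {h : V → V → ℝ} (hh : IsHeight Γ h) :
    IsInvariantSet Γ (strictlyAbove h : Set G.Path) := by
  intro γ ω hω e he
  obtain ⟨f, hf, rfl⟩ := List.mem_map.1 he
  rw [Path.first_map, hh.map_head]
  exact hω f hf

theorem isInvariantSet_weaklyAbove {h : V → V → ℝ} (hh : IsHeight Γ h) :
    IsInvariantSet Γ (weaklyAbove h : Set G.Path) := by
  intro γ ω hω e he
  obtain ⟨f, hf, rfl⟩ := List.mem_map.1 he
  rw [Path.first_map, hh.map_head]
  exact hω f hf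

theorem isInvariantSet_endsAtTop {h : V → V → ℝ} (hh : IsHeight Γ h) :
    IsInvariantSet Γ (endsAtTop h : Set G.Path) := by
  intro γ ω hω e he
  obtain ⟨f, hf, rfl⟩ := List.mem_map.1 he
  rw [Path.last_map, hh.map_tail]
  exact hω f hf

theorem isInvariantSet_height {h : V → V → ℝ} (hh : IsHeight Γ h) (p : ℝ → Prop) :
    IsInvariantSet Γ {ω : G.Path | p (h ω.first ω.last)} := by
  intro γ ω hω
  rw [Set.mem_ofPred_eq, hh.map_first_last]
  exact hω

theorem isInvariantSet_length (p : ℕ → Prop) :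
    IsInvariantSet Γ {ω : G.Path | p ω.length} := by
  intro γ ω hω
  rwa [Set.mem_ofPred_eq, Path.length_map]

theorem IsInvariantSet.inter {S T : Set G.Path} (hS : IsInvariantSet Γ S)
    (hT : IsInvariantSet Γ T) : IsInvariantSet Γ (S ∩ T) :=
  fun γ ω hω => ⟨hS γ ω hω.1, hT γ ω hω.2⟩

theorem IsHeight.last_nonneg {h : V → V → ℝ} (hh : IsHeight Γ h) {ω : G.Path}
    (hω : ω ∈ endsAtTop h) : 0 ≤ h ω.first ω.last := by
  obtain ⟨v, l, hl⟩ := ω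
  cases l with
  | nil => exact (hh.self v).ge
  | cons e l =>
    have := hω e (by simp)
    rwa [hl.1] at this

/-- The heads of the edges of a path other than the last one are tails of edges. -/
theorem head_mem_of_edges (ω : G.Path) : ∀ e ∈ ω.edges, G.head e = ω.last ∨
    ∃ f ∈ ω.edges, G.tail f = G.head e := by
  obtain ⟨v, l, hl⟩ := ω
  induction l generalizing v with
  | nil => simp
  | cons a l ih =>
    intro e he
    rcases List.mem_cons.1 he with rfl | he
    · cases l with
      | nil => exact Or.inl rfl
      | cons b l => exact Or.inr ⟨b, by simp, hl.2.1⟩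
    · rcases ih _ hl.2 e he with h | ⟨f, hf, h⟩
      · exact Or.inl h
      · exact Or.inr ⟨f, List.mem_cons_of_mem _ hf, h⟩

theorem IsHeight.head_le_last {h : V → V → ℝ} (hh : IsHeight Γ h) {ω : G.Path}
    (hω : ω ∈ endsAtTop h) {e : E} (he : e ∈ ω.edges) : 0 ≤ h (G.head e) ω.last := by
  rcases head_mem_of_edges ω e he with h1 | ⟨f, hf, h1⟩
  · rw [h1, hh.self]
  · rw [← h1]
    exact hω f hf

/-- Every path splits, at the last visit of its maximal height, into a path that ends at its top
and a path that stays strictly below its first vertex. -/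
theorem IsHeight.exists_split {h : V → V → ℝ} (hh : IsHeight Γ h) (ω : G.Path) :
    ∃ (α β : G.Path) (hab : α.last = β.first), ω = α.comp β hab ∧ α ∈ endsAtTop h ∧
      β ∈ strictlyAbove (-h) := by
  have key : ∀ (l : List E) (v : V), G.IsPathFrom v l → ∃ a b, l = a ++ b ∧
      0 ≤ h v (G.endpointFrom v a) ∧
      (∀ e ∈ a, 0 ≤ h (G.tail e) (G.endpointFrom v a)) ∧
      ∀ e ∈ b, 0 < h (G.head e) (G.endpointFrom v a) := by
    intro l
    induction l with
    | nil => exact fun v _ => ⟨[], [], rfl, (hh.self v).ge, by simp, by simp⟩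
    | cons e l ih =>
      intro v hl
      obtain ⟨a, b, rfl, h0, h1, h2⟩ := ih _ hl.2
      rcases le_or_gt 0 (h v (G.endpointFrom (G.head e) a)) with hv | hv
      · refine ⟨e :: a, b, rfl, hv, ?_, h2⟩
        intro f hf
        rcases List.mem_cons.1 hf with rfl | hf
        · rw [hl.1]
          exact hv
        · exact h1 f hf
      · refine ⟨[], e :: (a ++ b), rfl, (hh.self v).ge, by simp, ?_⟩
        intro f hf
        show 0 < h (G.head f) v
        have hv' := hh.swap v (G.endpointFrom (G.head e) a)
        have hc := hh.add (G.head f) (G.endpointFrom (G.head e) a) v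
        rcases List.mem_cons.1 hf with rfl | hf
        · linarith
        · rcases List.mem_append.1 hf with hf | hf
          · have := hh.head_le_last (ω := ⟨_, a, ((isPathFrom_append _ _ _ _).1 hl.2).1⟩) h1 hf
            change 0 ≤ h (G.head f) (G.endpointFrom (G.head e) a) at this
            linarith
          · linarith [h2 f hf]
  obtain ⟨a, b, hl, h0, h1, h2⟩ := key ω.edges ω.first ω.isPath
  obtain ⟨α, β, hab, rfl, h3, rfl, rfl⟩ := ω.exists_comp a b hl
  have hα : G.endpointFrom (α.comp β hab).first α.edges = α.last := rfl
  rw [hα] at h1 h2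
  refine ⟨α, β, hab, rfl, h1, fun e he => ?_⟩
  have := h2 e he
  rw [hab, hh.swap] at this
  simpa using this

/-! ### Tilted weights -/

/-- The standing assumptions: a good weight on a connected, locally finite graph and a transitive,
nonunimodular group of automorphisms. -/
structure IsNonunimodularModel (Γ : Subgroup G.Aut) (w : G.Path → ℝ≥0) : Prop where
  connected : G.IsConnected
  locallyFinite : G.IsLocallyFinite
  transitive : MulAction.IsPretransitive Γ V
  nonunimodular : ¬ IsUnimodular Γ
  good : IsGood Γ w

/-- The logarithm of the modular function. -/
noncomputable def height (Γ : Subgroup G.Aut) (x y : V) : ℝ := Real.log (modular Γ x y)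

/-- The weight `z^|ω| w(ω) Δ(ω⁻, ω⁺)^lam`; the modular function is based at the first vertex of
the path, which makes the weight `Γ`-invariant. -/
noncomputable def pathWeight (Γ : Subgroup G.Aut) (w : G.Path → ℝ≥0) (z : ℝ≥0∞) (lam : ℝ)
    (ω : G.Path) : ℝ≥0∞ :=
  z ^ ω.length * ((w ω * modular Γ ω.first ω.last ^ lam : ℝ≥0) : ℝ≥0∞)

namespace IsNonunimodularModel

theorem isHeight (hm : IsNonunimodularModel Γ w) : IsHeight Γ (height Γ) where
  add x y z := by
    have h1 := modular_pos (Γ := Γ) hm.connected hm.locallyFinite x y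
    have h2 := modular_pos (Γ := Γ) hm.connected hm.locallyFinite y z
    unfold height
    rw [← Real.log_mul (by exact_mod_cast h1.ne') (by exact_mod_cast h2.ne'),
      ← modular_mul hm.connected hm.locallyFinite x y z, NNReal.coe_mul]
  smul γ x y := by
    unfold height
    rw [modular_smul]

theorem modular_rpow (hm : IsNonunimodularModel Γ w) (lam : ℝ) (x y : V) :
    ((modular Γ x y ^ lam : ℝ≥0) : ℝ≥0∞) = ENNReal.ofReal (Real.exp (lam * height Γ x y)) := by
  have h1 := modular_pos (Γ := Γ) hm.connected hm.locallyFinite x y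
  rw [height, mul_comm, ← Real.rpow_def_of_pos (by exact_mod_cast h1), ← NNReal.coe_rpow,
    ENNReal.ofReal_coe_nnreal]

theorem isInvariantWeight (hm : IsNonunimodularModel Γ w) (z : ℝ≥0∞) (lam : ℝ) :
    IsInvariantWeight Γ (pathWeight Γ w z lam) := by
  intro γ ω
  unfold pathWeight
  have h : modular Γ (γ.1 • ω.first) (γ.1 • ω.last) = modular Γ ω.first ω.last :=
    modular_smul γ _ _
  rw [hm.good.invariant γ.1 γ.2, Path.length_map, Path.first_map, Path.last_map, h]

theorem modular_comp (hm : IsNonunimodularModel Γ w) (α β : G.Path) (h : α.last = β.first) :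
    modular Γ (α.comp β h).first (α.comp β h).last =
      modular Γ α.first α.last * modular Γ β.first β.last := by
  rw [Path.last_comp, Path.first_comp, ← h, modular_mul hm.connected hm.locallyFinite]

theorem isRepulsiveWeight (hm : IsNonunimodularModel Γ w) (z : ℝ≥0∞) (lam : ℝ) :
    IsRepulsiveWeight (pathWeight Γ w z lam) := by
  intro α β h
  unfold pathWeight
  rw [hm.modular_comp, NNReal.mul_rpow, Path.length_comp, pow_add, mul_mul_mul_comm,
    ← ENNReal.coe_mul, mul_mul_mul_comm (w α)]
  gcongr
  exact hm.good.repulsive α β h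

theorem pathWeight_comp (hm : IsNonunimodularModel Γ w) (z : ℝ≥0∞) (lam : ℝ) (α β : G.Path)
    (h : α.last = β.first) (hd : α.IsDisjoint β) :
    pathWeight Γ w z lam (α.comp β h) = pathWeight Γ w z lam α * pathWeight Γ w z lam β := by
  unfold pathWeight
  rw [hm.modular_comp, NNReal.mul_rpow, Path.length_comp, pow_add, mul_mul_mul_comm,
    ← ENNReal.coe_mul, mul_mul_mul_comm (w α), hm.good.zeroRange α β h hd]

theorem pathWeight_tilt (hm : IsNonunimodularModel Γ w) (z : ℝ≥0∞) (lam lam' : ℝ) (ω : G.Path) :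
    pathWeight Γ w z lam' ω = ENNReal.ofReal
      (Real.exp ((lam' - lam) * height Γ ω.first ω.last)) * pathWeight Γ w z lam ω := by
  unfold pathWeight
  rw [ENNReal.coe_mul, ENNReal.coe_mul, hm.modular_rpow, hm.modular_rpow, sub_mul, Real.exp_sub,
    ENNReal.ofReal_div_of_pos (Real.exp_pos _)]
  have h0 : ENNReal.ofReal (Real.exp (lam * height Γ ω.first ω.last)) ≠ 0 := by
    simpa using Real.exp_pos _
  rw [mul_comm (_ / _), mul_assoc, mul_assoc, ENNReal.mul_div_cancel h0 ENNReal.ofReal_ne_top]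

theorem pathWeight_le_tilt (hm : IsNonunimodularModel Γ w) (z : ℝ≥0∞) {lam lam' c : ℝ}
    {ω : G.Path} (h : (lam' - lam) * height Γ ω.first ω.last ≤ c) :
    pathWeight Γ w z lam' ω ≤ ENNReal.ofReal (Real.exp c) * pathWeight Γ w z lam ω := by
  rw [hm.pathWeight_tilt z lam lam']
  gcongr

end IsNonunimodularModel

theorem pow_mul_partitionFn (o : V) (z : ℝ≥0∞) (lam : ℝ) (n : ℕ) :
    z ^ n * partitionFn Γ w o lam n =
      pathSum (pathWeight Γ w z lam) o {ω | ω.length = n} := by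
  have : ∀ ω : G.pathsFrom o n, z ^ n * (tiltedWeight Γ w o lam ω : ℝ≥0∞) =
      pathWeight Γ w z lam ω := by
    rintro ⟨ω, h1, h2⟩
    simp only [tiltedWeight, pathWeight, h1, h2]
  rw [partitionFn, ← ENNReal.tsum_mul_left, tsum_congr this]
  rfl

theorem susceptibility_eq_pathSum (o : V) (z : ℝ≥0∞) (lam : ℝ) :
    susceptibility Γ w o z lam = pathSum (pathWeight Γ w z lam) o Set.univ := by
  unfold susceptibility
  rw [pathSum_eq_tsum_fiber _ _ _ Path.length]
  simp only [pow_mul_partitionFn, Set.univ_inter]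

theorem pathSum_le_susceptibility (o : V) (z : ℝ≥0∞) (lam : ℝ) (S : Set G.Path) :
    pathSum (pathWeight Γ w z lam) o S ≤ susceptibility Γ w o z lam := by
  rw [susceptibility_eq_pathSum]
  exact pathSum_mono_set _ _ (Set.subset_univ S)

theorem susceptibility_mono (o : V) {z z' : ℝ≥0∞} (h : z ≤ z') (lam : ℝ) :
    susceptibility Γ w o z lam ≤ susceptibility Γ w o z' lam := by
  unfold susceptibility
  gcongr

theorem susceptibility_lt_top {o : V} {z : ℝ≥0∞} {lam : ℝ} (h : z < zCrit Γ w o lam) :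
    susceptibility Γ w o z lam < ⊤ := by
  obtain ⟨z', hz', h'⟩ := lt_sSup_iff.1 h
  exact (susceptibility_mono o h'.le lam).trans_lt hz'

theorem le_zCrit {o : V} {z : ℝ≥0∞} {lam : ℝ} (h : susceptibility Γ w o z lam < ⊤) :
    z ≤ zCrit Γ w o lam := le_sSup h

namespace IsNonunimodularModel

/-- Reversing all paths turns the tilt `lam` into the tilt `1 - lam`. -/
theorem pathSum_le_reverse (hm : IsNonunimodularModel Γ w) (z : ℝ≥0∞) (lam : ℝ) (o : V)
    {S : Set G.Path} (hS : IsInvariantSet Γ S) :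
    pathSum (pathWeight Γ w z lam) o S ≤
      pathSum (pathWeight Γ w z (1 - lam)) o (Path.reverse ⁻¹' S) := by
  rw [pathSum_eq_tsum_fiber _ _ _ Path.last,
    pathSum_eq_tsum_fiber _ _ (Path.reverse ⁻¹' S) Path.last,
    tsum_mass_transport hm.connected hm.locallyFinite hm.transitive
      (fun x y => pathSum (pathWeight Γ w z lam) x (S ∩ {ω | ω.last = y}))]
  · refine ENNReal.tsum_le_tsum fun y => ?_
    rw [mul_comm, ← pathSum_const_mul]
    refine pathSum_le_of_injective Path.reverse Path.reverse_injective ?_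
    rintro ω h1 ⟨h2, h3⟩
    refine ⟨h3, ⟨?_, ?_⟩, ?_⟩
    · rwa [Set.mem_preimage, Path.reverse_reverse]
    · rw [Set.mem_ofPred_eq, Path.last_reverse, h1]
    · subst h1
      obtain rfl : ω.last = o := h3
      have h0 := modular_pos (Γ := Γ) hm.connected hm.locallyFinite ω.last ω.first
      unfold pathWeight
      rw [hm.good.reversible, Path.length_reverse, Path.first_reverse, Path.last_reverse,
        mul_left_comm, ← ENNReal.coe_mul, mul_left_comm (modular Γ _ _),
        modular_swap hm.connected hm.locallyFinite ω.last ω.first,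
        NNReal.rpow_sub h0.ne', NNReal.rpow_one, NNReal.inv_rpow, div_eq_mul_inv]
  · have key : ∀ (γ : Γ) x y, pathSum (pathWeight Γ w z lam) x (S ∩ {ω | ω.last = y}) ≤
        pathSum (pathWeight Γ w z lam) (γ • x) (S ∩ {ω | ω.last = γ • y}) := by
      intro γ x y
      refine pathSum_le_of_injective (Path.map γ.1) (Path.map_injective _) ?_
      rintro ω h1 ⟨h2, h3⟩
      refine ⟨?_, ⟨hS γ ω h2, ?_⟩, (hm.isInvariantWeight z lam γ ω).ge⟩
      · rw [Path.first_map, h1]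
        rfl
      · rw [Set.mem_ofPred_eq, Path.last_map, show ω.last = y from h3]
        rfl
    intro γ x y
    refine le_antisymm ?_ (key γ x y)
    have := key γ⁻¹ (γ • x) (γ • y)
    rwa [inv_smul_smul, inv_smul_smul] at this

theorem partitionFn_one_sub (hm : IsNonunimodularModel Γ w) (o : V) (lam : ℝ) (n : ℕ) :
    partitionFn Γ w o (1 - lam) n = partitionFn Γ w o lam n := by
  have key : ∀ lam : ℝ, partitionFn Γ w o lam n ≤ partitionFn Γ w o (1 - lam) n := by
    intro lam
    have h := hm.pathSum_le_reverse 1 lam o (isInvariantSet_length (G := G) (Γ := Γ) (· = n))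
    simp only [Set.preimage_ofPred_eq, Path.length_reverse] at h
    rwa [← pow_mul_partitionFn, ← pow_mul_partitionFn, one_pow, one_mul, one_mul] at h
  refine le_antisymm ?_ (key lam)
  have := key (1 - lam)
  rwa [sub_sub_cancel] at this

theorem susceptibility_one_sub (hm : IsNonunimodularModel Γ w) (o : V) (z : ℝ≥0∞) (lam : ℝ) :
    susceptibility Γ w o z (1 - lam) = susceptibility Γ w o z lam := by
  unfold susceptibility
  simp only [hm.partitionFn_one_sub]

theorem zCrit_one_sub (hm : IsNonunimodularModel Γ w) (o : V) (lam : ℝ) :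
    zCrit Γ w o (1 - lam) = zCrit Γ w o lam := by
  unfold zCrit
  simp only [hm.susceptibility_one_sub]

/-! ### Monotone paths -/

theorem exists_edge_modular_ne_one (hm : IsNonunimodularModel Γ w) :
    ∃ e : E, modular Γ (G.tail e) (G.head e) ≠ 1 := by
  by_contra! hc
  have key : ∀ (l : List E) (v : V), G.IsPathFrom v l → modular Γ v (G.endpointFrom v l) = 1 := by
    intro l
    induction l with
    | nil => exact fun v _ => modular_self hm.connected hm.locallyFinite v
    | cons e l ih =>
      intro v hl
      have h1 := hc e
      rw [hl.1] at h1
      have h2 := modular_mul (Γ := Γ) hm.connected hm.locallyFinite v (G.head e)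
        (G.endpointFrom (G.head e) l)
      rw [h1, ih _ hl.2, one_mul] at h2
      exact h2.symm
  refine hm.nonunimodular fun x y => ?_
  obtain ⟨ω, rfl, rfl⟩ := hm.connected x y
  exact key ω.edges ω.first ω.isPath

theorem exists_edge_from (hm : IsNonunimodularModel Γ w) (e : E) (v : V) :
    ∃ f : E, G.tail f = v ∧ modular Γ v (G.head f) = modular Γ (G.tail e) (G.head e) := by
  have := hm.transitive
  obtain ⟨γ, rfl⟩ := MulAction.exists_smul_eq Γ (G.tail e) v
  refine ⟨γ.1.1.2 e, tail_smul _ _, ?_⟩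
  rw [head_smul]
  exact modular_smul γ _ _

/-- There is `r > 1` such that every vertex has neighbours at modular distance `r` and `r⁻¹`. -/
theorem exists_steps (hm : IsNonunimodularModel Γ w) :
    ∃ r : ℝ≥0, 1 < r ∧ (∀ v, ∃ e : E, G.tail e = v ∧ modular Γ v (G.head e) = r) ∧
      ∀ v, ∃ e : E, G.tail e = v ∧ modular Γ v (G.head e) = r⁻¹ := by
  obtain ⟨e, he⟩ := hm.exists_edge_modular_ne_one
  have hrev : modular Γ (G.tail (G.rev e)) (G.head (G.rev e)) =
      (modular Γ (G.tail e) (G.head e))⁻¹ := by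
    rw [G.tail_rev, G.head_rev, modular_swap hm.connected hm.locallyFinite]
  rcases lt_or_gt_of_ne he with h | h
  · refine ⟨(modular Γ (G.tail e) (G.head e))⁻¹,
      (one_lt_inv₀ (modular_pos hm.connected hm.locallyFinite _ _)).2 h, fun v => ?_, fun v => ?_⟩
    · rw [← hrev]
      exact hm.exists_edge_from _ v
    · rw [inv_inv]
      exact hm.exists_edge_from _ v
  · refine ⟨_, h, fun v => hm.exists_edge_from _ v, fun v => ?_⟩
    rw [← hrev]
    exact hm.exists_edge_from _ v

theorem exists_chain (hm : IsNonunimodularModel Γ w) {r : ℝ≥0} (hr1 : r ≠ 1)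
    (hr : ∀ v, ∃ e : E, G.tail e = v ∧ modular Γ v (G.head e) = r) (n : ℕ) (v : V) :
    ∃ ω : G.Path, ω.first = v ∧ ω.length = n ∧ 1 ≤ w ω ∧ modular Γ v ω.last = r ^ n ∧
      ∀ e ∈ ω.edges, ∃ k, modular Γ v (G.head e) = r ^ (k + 1) := by
  induction n generalizing v with
  | zero =>
    refine ⟨Path.trivial v, rfl, rfl, (hm.good.weight_of_length_zero _ rfl).ge, ?_, ?_⟩
    · rw [pow_zero]
      exact modular_self hm.connected hm.locallyFinite v
    · intro e he
      exact absurd he List.not_mem_nil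
  | succ n ih =>
    obtain ⟨e, rfl, he⟩ := hr v
    obtain ⟨ω, h1, h2, h3, h4, h5⟩ := ih (G.head e)
    have hne : ∀ k, r ^ (k + 1) ≠ 1 := fun k hk =>
      hr1 ((pow_eq_one_iff_of_nonneg zero_le k.succ_ne_zero).1 hk)
    have hstep : ∀ x, modular Γ (G.tail e) x = r * modular Γ (G.head e) x := fun x => by
      rw [← he, modular_mul hm.connected hm.locallyFinite]
    have hheads : ∀ f ∈ ω.edges, ∃ k, modular Γ (G.tail e) (G.head f) = r ^ (k + 1) := by
      intro f hf
      obtain ⟨k, hk⟩ := h5 f hf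
      exact ⟨k + 1, by rw [hstep, hk, pow_succ' r (k + 1)]⟩
    have hd : (Path.single e).IsDisjoint ω := by
      intro e' he' f hf
      obtain rfl := List.mem_singleton.1 he'
      intro heq
      obtain ⟨k, hk⟩ := hheads f hf
      rw [← heq, modular_self hm.connected hm.locallyFinite] at hk
      exact hne k hk.symm
    have hjoin : (Path.single e).last = ω.first := h1.symm
    refine ⟨(Path.single e).comp ω hjoin, rfl, ?_, ?_, ?_, ?_⟩
    · rw [Path.length_comp, h2, Path.length_single, add_comm]
    · rw [hm.good.zeroRange _ _ _ hd]
      exact one_le_mul (hm.good.one_le_weight_of_length_one _ rfl) h3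
    · rw [Path.last_comp, hstep, h4, pow_succ']
    · intro f hf
      rcases List.mem_cons.1 hf with rfl | hf
      · exact ⟨0, by rw [he, zero_add, pow_one]⟩
      · exact hheads f hf

/-! ### The critical point -/

theorem partitionFn_zero (hm : IsNonunimodularModel Γ w) (o : V) (lam : ℝ) :
    partitionFn Γ w o lam 0 = 1 := by
  have h0 : ∀ ω : G.pathsFrom o 0, (tiltedWeight Γ w o lam ω : ℝ≥0∞) = 1 := by
    rintro ⟨ω, rfl, h2⟩
    rw [tiltedWeight, hm.good.weight_of_length_zero ω h2, Path.last_eq_first h2,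
      modular_self hm.connected hm.locallyFinite, NNReal.one_rpow, one_mul, ENNReal.coe_one]
  have : Unique (G.pathsFrom o 0) :=
    { default := ⟨Path.trivial o, rfl, rfl⟩
      uniq := by
        rintro ⟨ω, rfl, h2⟩
        exact Subtype.ext (Path.eq_trivial h2) }
  rw [partitionFn, tsum_congr h0, ENNReal.tsum_const]
  simp

theorem partitionFn_ne_top (hm : IsNonunimodularModel Γ w) (o : V) (lam : ℝ) (n : ℕ) :
    partitionFn Γ w o lam n ≠ ⊤ := by
  have := (finite_pathsFrom hm.locallyFinite n o).fintype
  rw [partitionFn, tsum_fintype]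
  exact ENNReal.sum_ne_top.2 fun _ _ => ENNReal.coe_ne_top

theorem partitionFn_add_le (hm : IsNonunimodularModel Γ w) (o : V) (lam : ℝ) (n m : ℕ) :
    partitionFn Γ w o lam (n + m) ≤ partitionFn Γ w o lam n * partitionFn Γ w o lam m := by
  have h := pathSum_le_mul hm.transitive (hm.isInvariantWeight 1 lam) (hm.isRepulsiveWeight 1 lam)
    (S := {ω | ω.length = n + m}) (A := {ω | ω.length = n}) (B := {ω | ω.length = m})
    (isInvariantSet_length (· = m)) o fun ω _ hω => ω.exists_comp_length hω
  simp only [← pow_mul_partitionFn, one_pow, one_mul] at h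
  exact h

theorem pow_le_partitionFn (hm : IsNonunimodularModel Γ w) (o : V) (lam : ℝ) {r : ℝ≥0}
    (hr1 : r ≠ 1)
    (hr : ∀ v, ∃ e : E, G.tail e = v ∧ modular Γ v (G.head e) = r) (n : ℕ) :
    ((r ^ lam : ℝ≥0) : ℝ≥0∞) ^ n ≤ partitionFn Γ w o lam n := by
  obtain ⟨ω, h1, h2, h3, h4, -⟩ := hm.exists_chain hr1 hr n o
  refine le_trans ?_ (ENNReal.le_tsum (⟨ω, h1, h2⟩ : G.pathsFrom o n))
  rw [tiltedWeight, h4, ← ENNReal.coe_pow, ENNReal.coe_le_coe, ← NNReal.rpow_natCast,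
    ← NNReal.rpow_natCast, ← NNReal.rpow_mul, ← NNReal.rpow_mul, mul_comm lam]
  exact le_mul_of_one_le_left zero_le h3

end IsNonunimodularModel

theorem _root_.ENNReal.tsum_lt_top_of_submultiplicative {a : ℕ → ℝ≥0∞} (hfin : ∀ n, a n ≠ ⊤)
    (h0 : a 0 ≤ 1) (hsub : ∀ n m, a (n + m) ≤ a n * a m) {n : ℕ} (hn : n ≠ 0) (h1 : a n < 1) :
    ∑' m, a m < ⊤ := by
  have : NeZero n := ⟨hn⟩
  have hpow : ∀ q, a (q * n) ≤ a n ^ q := by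
    intro q
    induction q with
    | zero => simpa using h0
    | succ q ih =>
      rw [Nat.succ_mul, pow_succ]
      exact (hsub _ _).trans (mul_le_mul_left ih _)
  rw [← (Nat.divModEquiv n).symm.tsum_eq]
  calc ∑' p : ℕ × Fin n, a ((Nat.divModEquiv n).symm p)
      ≤ ∑' p : ℕ × Fin n, a n ^ p.1 * a p.2 := by
        refine ENNReal.tsum_le_tsum fun p => ?_
        have : (Nat.divModEquiv n).symm p = p.1 * n + p.2 := by
          simp [Nat.divModEquiv]
        rw [this]
        exact (hsub _ _).trans (mul_le_mul_left (hpow _) _)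
    _ = (∑' q, a n ^ q) * ∑' s : Fin n, a s := by
        rw [ENNReal.tsum_prod', ← ENNReal.tsum_mul_right]
        simp only [ENNReal.tsum_mul_left]
    _ < ⊤ := by
        refine ENNReal.mul_lt_top ?_ ?_
        · rw [ENNReal.tsum_geometric, ENNReal.inv_lt_top]
          exact tsub_pos_of_lt h1
        · rw [tsum_fintype]
          exact (ENNReal.sum_lt_top).2 fun s _ => (hfin s).lt_top

namespace IsNonunimodularModel

theorem susceptibility_lt_top_of_lt_one (hm : IsNonunimodularModel Γ w) (o : V) {z : ℝ≥0∞}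
    (hz : z ≠ ⊤) (lam : ℝ) {n : ℕ} (hn : n ≠ 0) (h : z ^ n * partitionFn Γ w o lam n < 1) :
    susceptibility Γ w o z lam < ⊤ := by
  refine ENNReal.tsum_lt_top_of_submultiplicative (fun n => ?_) ?_ (fun n m => ?_) hn h
  · exact ENNReal.mul_ne_top (ENNReal.pow_ne_top hz) (hm.partitionFn_ne_top o lam n)
  · rw [hm.partitionFn_zero, pow_zero, one_mul]
  · rw [pow_add, mul_mul_mul_comm]
    gcongr
    exact hm.partitionFn_add_le o lam n m

theorem zCrit_pos (hm : IsNonunimodularModel Γ w) (o : V) (lam : ℝ) : 0 < zCrit Γ w o lam := by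
  have hZ := hm.partitionFn_ne_top o lam 1
  have h0 : 0 < (partitionFn Γ w o lam 1 + 1)⁻¹ := ENNReal.inv_pos.2 (by simp [hZ])
  refine h0.trans_le (le_zCrit (hm.susceptibility_lt_top_of_lt_one o ?_ lam one_ne_zero ?_))
  · simp
  · rw [pow_one, mul_comm, ← div_eq_mul_inv]
    refine ENNReal.div_lt_of_lt_mul ?_
    rw [one_mul]
    exact ENNReal.lt_add_right hZ one_ne_zero

theorem zCrit_ne_top (hm : IsNonunimodularModel Γ w) (o : V) (lam : ℝ) :
    zCrit Γ w o lam ≠ ⊤ := by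
  obtain ⟨r, hr, hr', -⟩ := hm.exists_steps
  intro htop
  have hpos : r ^ lam ≠ 0 := (NNReal.rpow_pos (zero_lt_one.trans hr)).ne'
  have hlt : ((r ^ lam : ℝ≥0) : ℝ≥0∞)⁻¹ < zCrit Γ w o lam := by
    rw [htop, ENNReal.inv_lt_top]
    exact_mod_cast pos_iff_ne_zero.2 hpos
  refine (susceptibility_lt_top hlt).ne (top_le_iff.1 ?_)
  calc (⊤ : ℝ≥0∞) = ∑' _ : ℕ, 1 := by
        rw [ENNReal.tsum_const]
        simp
    _ ≤ _ := by
        refine ENNReal.tsum_le_tsum fun n => ?_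
        have h := hm.pow_le_partitionFn o lam hr.ne' hr' n
        have h1 : ((r ^ lam : ℝ≥0) : ℝ≥0∞) ≠ 0 := by exact_mod_cast hpos
        calc (1 : ℝ≥0∞) = (((r ^ lam : ℝ≥0) : ℝ≥0∞)⁻¹) ^ n * ((r ^ lam : ℝ≥0) : ℝ≥0∞) ^ n := by
              rw [← mul_pow, ENNReal.inv_mul_cancel h1 ENNReal.coe_ne_top, one_pow]
          _ ≤ _ := by gcongr

/-- By submultiplicativity, `Z_w(lam; n)` is at least the `n`-th power of its growth rate. -/
theorem one_le_zCrit_pow_mul (hm : IsNonunimodularModel Γ w) (o : V) (lam : ℝ) (n : ℕ) :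
    1 ≤ zCrit Γ w o lam ^ n * partitionFn Γ w o lam n := by
  rcases eq_or_ne n 0 with rfl | hn
  · rw [hm.partitionFn_zero, pow_zero, one_mul]
  by_contra! hlt
  have hc : Continuous fun z : ℝ≥0∞ => z ^ n * partitionFn Γ w o lam n :=
    (ENNReal.continuous_mul_const (hm.partitionFn_ne_top o lam n)).comp (ENNReal.continuous_pow n)
  have hev := (hc.tendsto (zCrit Γ w o lam)).eventually (gt_mem_nhds hlt)
  have htop := (hm.zCrit_ne_top o lam).lt_top
  have : (nhdsWithin (zCrit Γ w o lam) (Set.Ioi (zCrit Γ w o lam))).NeBot :=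
    nhdsGT_neBot_of_exists_gt ⟨⊤, htop⟩
  obtain ⟨z, hz1, hz2, hz3⟩ := ((hev.filter_mono nhdsWithin_le_nhds).and
    (Ioo_mem_nhdsGT htop)).exists
  exact hz2.not_ge (le_zCrit (hm.susceptibility_lt_top_of_lt_one o hz3.ne lam hn hz1))

theorem susceptibility_zCrit (hm : IsNonunimodularModel Γ w) (o : V) (lam : ℝ) :
    susceptibility Γ w o (zCrit Γ w o lam) lam = ⊤ := by
  refine top_le_iff.1 ?_
  calc (⊤ : ℝ≥0∞) = ∑' _ : ℕ, 1 := by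
        rw [ENNReal.tsum_const]
        simp
    _ ≤ _ := ENNReal.tsum_le_tsum fun n => hm.one_le_zCrit_pow_mul o lam n

theorem lt_zCrit (hm : IsNonunimodularModel Γ w) {o : V} {z : ℝ≥0∞} {lam : ℝ}
    (h : susceptibility Γ w o z lam < ⊤) : z < zCrit Γ w o lam := by
  refine lt_of_le_of_ne (le_zCrit h) ?_
  rintro rfl
  exact h.ne (hm.susceptibility_zCrit o lam)

end IsNonunimodularModel

/-! ### Bridges -/

theorem Path.map_comp (γ : G.Aut) (α β : G.Path) (hab : α.last = β.first)
    (hab' : (α.map γ).last = (β.map γ).first) :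
    (α.comp β hab).map γ = (α.map γ).comp (β.map γ) hab' :=
  Path.ext rfl (List.map_append ..)

theorem IsHeight.isDisjoint {h : V → V → ℝ} (hh : IsHeight Γ h) {α β : G.Path}
    (hab : α.last = β.first) (hα : α ∈ endsAtTop h) (hβ : β ∈ strictlyAbove h) :
    α.IsDisjoint β := by
  intro e he f hf heq
  have h1 := hα e he
  have h2 := hβ f hf
  rw [← heq, ← hab, hh.swap] at h2
  linarith

theorem IsHeight.comp_mem_strictlyAbove {h : V → V → ℝ} (hh : IsHeight Γ h) {α β : G.Path}
    (hab : α.last = β.first) (hα : α ∈ endsAtTop h) (hα' : α ∈ strictlyAbove h)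
    (hβ : β ∈ strictlyAbove h) : α.comp β hab ∈ strictlyAbove h := by
  intro e he
  rcases List.mem_append.1 he with he | he
  · exact hα' e he
  · have h1 := hβ e he
    have h2 := hh.last_nonneg hα
    have h3 := hh.add α.first α.last (G.head e)
    rw [hab] at h2 h3
    rw [Path.first_comp]
    linarith

/-- A bound on a generating function below `z₀` extends to `z₀`. -/
theorem pathSum_le_of_forall_lt {o : V} {z₀ : ℝ≥0∞} (h0 : 0 < z₀) {lam : ℝ} {S : Set G.Path}
    {c : ℝ≥0∞} (h : ∀ z < z₀, pathSum (pathWeight Γ w z lam) o S ≤ c) :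
    pathSum (pathWeight Γ w z₀ lam) o S ≤ c := by
  unfold pathSum at *
  rw [ENNReal.tsum_eq_iSup_sum]
  refine iSup_le fun F => ?_
  have hc : Continuous fun z : ℝ≥0∞ => ∑ ω ∈ F, pathWeight Γ w z lam ω :=
    continuous_finsetSum _ fun ω _ =>
      (ENNReal.continuous_mul_const ENNReal.coe_ne_top).comp (ENNReal.continuous_pow _)
  have : (nhdsWithin z₀ (Set.Iio z₀)).NeBot := nhdsLT_neBot_of_exists_lt ⟨0, h0⟩
  have hlim : Filter.Tendsto _ (nhdsWithin z₀ (Set.Iio z₀)) _ :=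
    (hc.tendsto z₀).mono_left nhdsWithin_le_nhds
  refine le_of_tendsto hlim ?_
  filter_upwards [self_mem_nhdsWithin] with z hz
  exact (ENNReal.sum_le_tsum F).trans (h z hz)

namespace IsNonunimodularModel

/-- Bridges concatenate without loss of weight. Hence, if the bridges of a family can be read off
uniquely from their concatenations, all powers of the generating function of the family are bounded
by the susceptibility, and the generating function is at most one up to the critical point. -/
theorem pathSum_bridge_le_one (hm : IsNonunimodularModel Γ w) {h : V → V → ℝ} (hh : IsHeight Γ h)
    (o : V) (lam : ℝ) {S : Set G.Path} (hS : IsInvariantSet Γ S) (habove : S ⊆ strictlyAbove h)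
    (htop : S ⊆ endsAtTop h)
    (hinj : ∀ α α' β β' : G.Path, α ∈ S → α' ∈ S → α.first = α'.first → α.last = β.first →
      α'.last = β'.first →
      α.edges ++ β.edges = α'.edges ++ β'.edges → α.edges.length = α'.edges.length) :
    pathSum (pathWeight Γ w (zCrit Γ w o lam) lam) o S ≤ 1 := by
  refine pathSum_le_of_forall_lt (hm.zCrit_pos o lam) fun z hz => ?_
  have hpow : ∀ k : ℕ, ∃ T : Set G.Path, IsInvariantSet Γ T ∧ T ⊆ strictlyAbove h ∧
      pathSum (pathWeight Γ w z lam) o S ^ k ≤ pathSum (pathWeight Γ w z lam) o T := by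
    intro k
    induction k with
    | zero =>
      refine ⟨{ω | ω.length = 0}, isInvariantSet_length (· = 0), ?_, ?_⟩
      · intro ω hω e he
        rw [List.length_eq_zero_iff.1 hω] at he
        exact absurd he List.not_mem_nil
      · rw [← pow_mul_partitionFn, hm.partitionFn_zero, pow_zero, pow_zero, one_mul]
    | succ k ih =>
      obtain ⟨T, hT, hT', hle⟩ := ih
      refine ⟨{ω | ∃ (α β : G.Path) (hab : α.last = β.first), α ∈ S ∧ β ∈ T ∧ ω = α.comp β hab},
        ?_, ?_, ?_⟩
      · rintro γ _ ⟨α, β, hab, hα, hβ, rfl⟩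
        have hab' : (α.map γ.1).last = (β.map γ.1).first := by
          rw [Path.last_map, hab, Path.first_map]
        exact ⟨_, _, hab', hS γ α hα, hT γ β hβ, Path.map_comp _ _ _ _ _⟩
      · rintro _ ⟨α, β, hab, hα, hβ, rfl⟩
        exact hh.comp_mem_strictlyAbove hab (htop hα) (habove hα) (hT' hβ)
      · rw [pow_succ']
        refine (mul_le_mul_right hle _).trans ?_
        exact mul_pathSum_le hm.transitive (hm.isInvariantWeight z lam) hT o
          (fun α β hab hα hβ => ⟨⟨α, β, hab, hα, hβ, rfl⟩, (hm.pathWeight_comp z lam α β hab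
            (hh.isDisjoint hab (htop hα) (hT' hβ))).ge⟩)
          fun α α' β β' hα hα' _ _ => hinj α α' β β' hα hα'
  by_contra! hlt
  have hbig := ENNReal.tendsto_pow_atTop_nhds_top_iff.2 hlt
  obtain ⟨k, hk⟩ := (hbig.eventually (lt_mem_nhds (susceptibility_lt_top hz))).exists
  obtain ⟨T, -, -, hle⟩ := hpow k
  exact absurd (hle.trans (pathSum_le_susceptibility o z lam T)) hk.not_ge

end IsNonunimodularModel

/-- The paths that start at their minimal and end at their maximal height, possibly returning to
the minimal height. -/
def weakBridge (h : V → V → ℝ) : Set G.Path := weaklyAbove h ∩ endsAtTop h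

/-- The paths that stay strictly above their first vertex, end at a height at least `t`, and stay
below height `t` before. -/
def firstPassage (h : V → V → ℝ) (t : ℝ) : Set G.Path :=
  {ω | ω ∈ strictlyAbove h ∧ t ≤ h ω.first ω.last ∧ ∀ e ∈ ω.edges, h ω.first (G.tail e) < t}

theorem isInvariantSet_weakBridge {h : V → V → ℝ} (hh : IsHeight Γ h) :
    IsInvariantSet Γ (weakBridge h : Set G.Path) :=
  (isInvariantSet_weaklyAbove hh).inter (isInvariantSet_endsAtTop hh)

theorem isInvariantSet_firstPassage {h : V → V → ℝ} (hh : IsHeight Γ h) (t : ℝ) :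
    IsInvariantSet Γ (firstPassage h t : Set G.Path) := by
  rintro γ ω ⟨h1, h2, h3⟩
  refine ⟨isInvariantSet_strictlyAbove hh γ ω h1, ?_, ?_⟩
  · rwa [hh.map_first_last]
  · intro e he
    obtain ⟨f, hf, rfl⟩ := List.mem_map.1 he
    rw [Path.first_map, hh.map_tail']
    exact h3 f hf

theorem firstPassage_subset_endsAtTop {h : V → V → ℝ} (hh : IsHeight Γ h) (t : ℝ) :
    (firstPassage h t : Set G.Path) ⊆ endsAtTop h := by
  rintro ω ⟨-, h2, h3⟩ e he
  have h4 := h3 e he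
  have h5 := hh.add ω.first (G.tail e) ω.last
  linarith

theorem firstPassage_length_le {h : V → V → ℝ} {t : ℝ} {α α' β β' : G.Path}
    (hα : α ∈ firstPassage h t) (hα' : α' ∈ firstPassage h t) (hfirst : α.first = α'.first)
    (he : α.edges ++ β.edges = α'.edges ++ β'.edges) : α'.edges.length ≤ α.edges.length := by
  rcases List.append_eq_append_iff.1 he with ⟨c, hc, -⟩ | ⟨c, hc, -⟩
  · cases c with
    | nil => simp [hc]
    | cons e c =>
      -- The tail of `e` is the last vertex of `α`, which is too high for `α'`.
      have hp := α'.isPath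
      rw [hc, isPathFrom_append, ← hfirst] at hp
      have h1 := hα'.2.2 e (by simp [hc])
      rw [hp.2.1, ← hfirst] at h1
      exact absurd hα.2.1 (not_le.2 h1)
  · simp [hc]

theorem mem_rev_of_mem_reverse {ω : G.Path} {e : E} (he : e ∈ ω.edges) :
    G.rev e ∈ ω.reverse.edges := by
  simp only [Path.reverse, List.mem_reverse, List.mem_map]
  exact ⟨e, he, rfl⟩

theorem reverse_preimage_endsAtTop {h : V → V → ℝ} (hh : IsHeight Γ h) :
    Path.reverse ⁻¹' (endsAtTop h : Set G.Path) ⊆ weaklyAbove (-h) := by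
  intro ω hω e he
  have := hω _ (mem_rev_of_mem_reverse he)
  rw [G.tail_rev, Path.last_reverse, hh.swap] at this
  simpa using this

theorem reverse_preimage_weaklyAbove {h : V → V → ℝ} (hh : IsHeight Γ h) :
    Path.reverse ⁻¹' (weaklyAbove h : Set G.Path) ⊆ endsAtTop (-h) := by
  intro ω hω e he
  have := hω _ (mem_rev_of_mem_reverse he)
  rw [G.head_rev, Path.first_reverse, hh.swap] at this
  simpa using this

namespace IsNonunimodularModel

theorem pathSum_firstPassage_le_one (hm : IsNonunimodularModel Γ w) {h : V → V → ℝ}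
    (hh : IsHeight Γ h) (o : V) (lam : ℝ) (t : ℝ) :
    pathSum (pathWeight Γ w (zCrit Γ w o lam) lam) o (firstPassage h t) ≤ 1 :=
  hm.pathSum_bridge_le_one hh o lam (isInvariantSet_firstPassage hh t) (fun _ hω => hω.1)
    (firstPassage_subset_endsAtTop hh t) fun _ _ _ _ hα hα' hf _ _ he =>
      le_antisymm (firstPassage_length_le hα' hα hf.symm he.symm)
        (firstPassage_length_le hα hα' hf he)

theorem exists_up_step (hm : IsNonunimodularModel Γ w) :
    ∃ s : ℝ, 0 < s ∧ ∀ v, ∃ e : E, G.tail e = v ∧ height Γ v (G.head e) = s := by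
  obtain ⟨r, hr, hr', -⟩ := hm.exists_steps
  refine ⟨Real.log r, Real.log_pos (by exact_mod_cast hr), fun v => ?_⟩
  obtain ⟨e, he, he'⟩ := hr' v
  exact ⟨e, he, by rw [height, he']⟩

/-- A weak bridge of height between `t` and `t + s`, extended by an upward step at either end, is a
first passage above `t + 2 * s`. Hence the generating function of such bridges is bounded uniformly
in `t` up to the critical point. -/
theorem exists_pathSum_weakBridge_le (hm : IsNonunimodularModel Γ w) (o : V) (lam : ℝ) {s : ℝ}
    (hs : 0 < s) (hstep : ∀ v, ∃ e : E, G.tail e = v ∧ height Γ v (G.head e) = s) :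
    ∃ C : ℝ≥0∞, C ≠ ⊤ ∧ ∀ t : ℝ, pathSum (pathWeight Γ w (zCrit Γ w o lam) lam) o
      (weakBridge (height Γ) ∩ {ω | t ≤ height Γ ω.first ω.last ∧
        height Γ ω.first ω.last < t + s}) ≤ C := by
  set z := zCrit Γ w o lam with hz
  set h := height Γ with hh'
  have hh : IsHeight Γ h := hm.isHeight
  set W := pathWeight Γ w z lam with hW
  let A : Set G.Path := {ω | ω.length = 1} ∩ {ω | h ω.first ω.last = s}
  have hAinv : IsInvariantSet Γ A :=
    (isInvariantSet_length (· = 1)).inter (isInvariantSet_height hh (· = s))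
  have hA0 : pathSum W o A ≠ 0 := by
    obtain ⟨e, rfl, he'⟩ := hstep o
    have hle := ENNReal.le_tsum (f := fun ω : ↥({ω : G.Path | ω.first = G.tail e} ∩ A) => W ω)
      ⟨Path.single e, rfl, rfl, he'⟩
    refine (lt_of_lt_of_le ?_ hle).ne'
    have h1 := hm.good.one_le_weight_of_length_one (Path.single e) rfl
    have h2 : 0 < modular Γ (G.tail e) (G.head e) ^ lam :=
      NNReal.rpow_pos (modular_pos hm.connected hm.locallyFinite _ _)
    have h3 : 0 < w (Path.single e) * modular Γ (G.tail e) (G.head e) ^ lam :=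
      mul_pos (zero_lt_one.trans_le h1) h2
    simp only [hW, pathWeight, Path.length_single, pow_one, Path.first_single, Path.last_single]
    exact ENNReal.mul_pos (hm.zCrit_pos _ lam).ne' (by exact_mod_cast h3.ne')
  -- The edge of a path in `A`.
  have hAedge : ∀ α ∈ A, ∃ e, α.edges = [e] ∧ G.tail e = α.first ∧ G.head e = α.last ∧
      h α.first α.last = s := by
    rintro ⟨v, l, hl⟩ ⟨h1, h2⟩
    obtain ⟨e, rfl⟩ := List.length_eq_one_iff.1 h1
    exact ⟨e, rfl, hl.1, rfl, h2⟩
  refine ⟨(pathSum W o A * pathSum W o A)⁻¹, ENNReal.inv_ne_top.2 (mul_ne_zero hA0 hA0),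
    fun t => ?_⟩
  set B : Set G.Path := weakBridge h ∩ {ω | t ≤ h ω.first ω.last ∧ h ω.first ω.last < t + s}
    with hB
  have hBinv : IsInvariantSet Γ B :=
    (isInvariantSet_weakBridge hh).inter (isInvariantSet_height hh fun x => t ≤ x ∧ x < t + s)
  let Q : Set G.Path := (strictlyAbove h ∩ endsAtTop h) ∩
    {ω | t + s ≤ h ω.first ω.last ∧ h ω.first ω.last < t + 2 * s}
  have hQ : pathSum W o A * pathSum W o B ≤ pathSum W o Q := by
    refine mul_pathSum_le hm.transitive (hm.isInvariantWeight z lam) hBinv o ?_ ?_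
    · rintro α β hab hα ⟨⟨hβ1, hβ2⟩, hβ3, hβ4⟩
      obtain ⟨e, he, he1, he2, he3⟩ := hAedge α hα
      have hadd : ∀ x, h α.first x = s + h β.first x := fun x => by
        rw [← hh.add α.first α.last x, he3, hab]
      refine ⟨⟨⟨?_, ?_⟩, ?_⟩, (hm.pathWeight_comp z lam α β hab ?_).ge⟩
      · intro f hf
        rw [Path.edges_comp, he] at hf
        rw [Path.first_comp]
        rcases List.mem_cons.1 hf with rfl | hf
        · rw [he2, he3]
          exact hs
        · rw [hadd]
          have := hβ1 f hf
          linarith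
      · intro f hf
        rw [Path.edges_comp, he] at hf
        rw [Path.last_comp]
        rcases List.mem_cons.1 hf with rfl | hf
        · rw [he1, hadd]
          have := hh.last_nonneg hβ2
          linarith
        · exact hβ2 f hf
      · simp only [Set.mem_ofPred_eq, Path.first_comp, Path.last_comp, hadd]
        constructor <;> linarith
      · intro f hf g hg heq
        rw [he, List.mem_singleton] at hf
        subst hf
        have h1 := hβ1 g hg
        have h2 := hadd (G.head g)
        rw [← he1, heq, hh.self] at h2
        linarith
    · intro α α' β β' hα hα' _ _ _ _ _ _
      exact Eq.trans hα.1 (Eq.symm hα'.1)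
  have hP : pathSum W o Q * pathSum W o A ≤ pathSum W o (firstPassage h (t + 2 * s)) := by
    refine mul_pathSum_le hm.transitive (hm.isInvariantWeight z lam) hAinv o ?_ ?_
    · rintro α β hab ⟨⟨hα1, hα2⟩, hα3, hα4⟩ hβ
      obtain ⟨e, he, he1, he2, he3⟩ := hAedge β hβ
      have hβ' : β ∈ strictlyAbove h := by
        intro f hf
        rw [he, List.mem_singleton] at hf
        subst hf
        rw [he2, he3]
        exact hs
      refine ⟨⟨hh.comp_mem_strictlyAbove hab hα2 hα1 hβ', ?_, ?_⟩,
        (hm.pathWeight_comp z lam α β hab (hh.isDisjoint hab hα2 hβ')).ge⟩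
      · rw [Path.first_comp, Path.last_comp, ← hh.add α.first α.last, hab, he3, ← hab]
        linarith
      · intro f hf
        rw [Path.edges_comp, he] at hf
        rw [Path.first_comp]
        rcases List.mem_append.1 hf with hf | hf
        · have h1 := hα2 f hf
          have h2 := hh.add α.first (G.tail f) α.last
          linarith
        · rw [List.mem_singleton] at hf
          subst hf
          rw [he1, ← hab]
          exact hα4
    · intro α α' β β' _ _ hβ hβ' _ _ _ he
      have h1 := congrArg List.length he
      rw [List.length_append, List.length_append] at h1
      have h2 : β.edges.length = 1 := hβ.1
      have h3 : β'.edges.length = 1 := hβ'.1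
      omega
  have h1 : pathSum W o A * pathSum W o B * pathSum W o A ≤ 1 :=
    (mul_le_mul_left hQ _).trans (hP.trans (hm.pathSum_firstPassage_le_one hh o lam _))
  refine ENNReal.le_inv_iff_mul_le.2 ?_
  calc pathSum W o B * (pathSum W o A * pathSum W o A) =
      pathSum W o A * pathSum W o B * pathSum W o A := by ring
    _ ≤ 1 := h1

theorem pathSum_weakBridge_lt_top (hm : IsNonunimodularModel Γ w) (o : V) {lam lam' : ℝ}
    (hlam : lam' < lam) :
    pathSum (pathWeight Γ w (zCrit Γ w o lam) lam') o (weakBridge (height Γ)) < ⊤ := by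
  obtain ⟨s, hs, hstep⟩ := hm.exists_up_step
  obtain ⟨C, hC, hle⟩ := hm.exists_pathSum_weakBridge_le o lam hs hstep
  set z := zCrit Γ w o lam
  have hcover := pathSum_iUnion_le (pathWeight Γ w z lam') o (S := weakBridge (height Γ))
    (fun k : ℕ => weakBridge (height Γ) ∩ {ω : G.Path | k * s ≤ height Γ ω.first ω.last ∧
      height Γ ω.first ω.last < k * s + s}) (by
    intro ω _ hω
    have h0 := hm.isHeight.last_nonneg hω.2
    have h1 := Nat.floor_le (div_nonneg h0 hs.le)
    have h2 := Nat.lt_floor_add_one (height Γ ω.first ω.last / s)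
    rw [le_div_iff₀ hs] at h1
    rw [div_lt_iff₀ hs, add_mul, one_mul] at h2
    exact ⟨_, hω, h1, h2⟩)
  refine hcover.trans_lt ?_
  set q : ℝ≥0∞ := ENNReal.ofReal (Real.exp ((lam' - lam) * s)) with hq
  have hq1 : q < 1 := by
    rw [hq, ENNReal.ofReal_lt_one, Real.exp_lt_one_iff]
    exact mul_neg_of_neg_of_pos (by linarith) hs
  calc _ ≤ ∑' k : ℕ, q ^ k * C := by
        refine ENNReal.tsum_le_tsum fun k => ?_
        refine le_trans ?_ (mul_le_mul_right (hle (k * s)) _)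
        rw [← pathSum_const_mul]
        refine pathSum_mono fun ω _ hω => ?_
        rw [hq, ← ENNReal.ofReal_pow (Real.exp_pos _).le, ← Real.exp_nat_mul]
        refine hm.pathWeight_le_tilt z ?_
        have h1 : (k : ℝ) * s ≤ height Γ ω.first ω.last := hω.2.1
        nlinarith
    _ = (1 - q)⁻¹ * C := by rw [ENNReal.tsum_mul_right, ENNReal.tsum_geometric]
    _ < ⊤ := ENNReal.mul_lt_top (ENNReal.inv_lt_top.2 (tsub_pos_of_lt hq1)) hC.lt_top

theorem pathSum_weakBridge_neg_lt_top (hm : IsNonunimodularModel Γ w) (o : V) {lam lam' : ℝ}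
    (hlam : 1 - lam < lam') :
    pathSum (pathWeight Γ w (zCrit Γ w o lam) lam') o (weakBridge (-height Γ)) < ⊤ := by
  refine (hm.pathSum_le_reverse _ lam' o (isInvariantSet_weakBridge hm.isHeight.neg)).trans_lt ?_
  refine (pathSum_mono_set _ _ ?_).trans_lt
    (hm.pathSum_weakBridge_lt_top o (lam := lam) (lam' := 1 - lam') (by linarith))
  intro ω hω
  have h1 := reverse_preimage_endsAtTop hm.isHeight.neg hω.2
  have h2 := reverse_preimage_weaklyAbove hm.isHeight.neg hω.1
  rw [neg_neg] at h1 h2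
  exact ⟨h1, h2⟩

end IsNonunimodularModel

/-! ### The Hammersley–Welsh decomposition -/

/-- The paths that stay strictly above their first vertex and strictly below height `t`. -/
def slab (h : V → V → ℝ) (t : ℝ) : Set G.Path :=
  {ω | ω ∈ strictlyAbove h ∧ ∀ e ∈ ω.edges, h ω.first (G.head e) < t}

theorem isInvariantSet_slab {h : V → V → ℝ} (hh : IsHeight Γ h) (t : ℝ) :
    IsInvariantSet Γ (slab h t : Set G.Path) := by
  rintro γ ω ⟨h1, h2⟩
  refine ⟨isInvariantSet_strictlyAbove hh γ ω h1, ?_⟩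
  intro e he
  obtain ⟨f, hf, rfl⟩ := List.mem_map.1 he
  rw [Path.first_map, hh.map_head]
  exact h2 f hf

/-- The generating function of the upward and downward weak bridges of height exactly `u`. -/
noncomputable def bridgeMass (W : G.Path → ℝ≥0∞) (o : V) (h : V → V → ℝ) (u : ℝ) : ℝ≥0∞ :=
  pathSum W o (weakBridge h ∩ {ω | h ω.first ω.last = u}) +
    pathSum W o (weakBridge (-h) ∩ {ω | (-h) ω.first ω.last = u})

theorem bridgeMass_neg (W : G.Path → ℝ≥0∞) (o : V) (h : V → V → ℝ) (u : ℝ) :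
    bridgeMass W o (-h) u = bridgeMass W o h u := by
  rw [bridgeMass, neg_neg, add_comm, bridgeMass]

theorem sum_bridgeMass_le (W : G.Path → ℝ≥0∞) (o : V) (h : V → V → ℝ) (T : Finset ℝ) :
    ∑ u ∈ T, bridgeMass W o h u ≤
      pathSum W o (weakBridge h) + pathSum W o (weakBridge (-h)) := by
  simp only [bridgeMass, Finset.sum_add_distrib]
  rw [pathSum_eq_tsum_fiber W o (weakBridge h) fun ω => h ω.first ω.last,
    pathSum_eq_tsum_fiber W o (weakBridge (-h)) fun ω => (-h) ω.first ω.last]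
  exact add_le_add (ENNReal.sum_le_tsum T) (ENNReal.sum_le_tsum T)

theorem Path.exists_head_eq_last {ω : G.Path} (hω : ω.edges ≠ []) :
    ∃ e ∈ ω.edges, G.head e = ω.last := by
  rcases List.eq_nil_or_concat ω.edges with h | ⟨l, e, h⟩
  · exact absurd h hω
  · rw [List.concat_eq_append] at h
    refine ⟨e, by simp [h], ?_⟩
    unfold Path.last
    rw [h, endpointFrom_append]
    rfl

theorem Path.exists_initial_last_eq_head {ω : G.Path} {e : E} (he : e ∈ ω.edges) :
    ∃ α : G.Path, α.first = ω.first ∧ α.last = G.head e ∧ α.length ≤ ω.length := by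
  obtain ⟨a, b, hab⟩ := List.append_of_mem he
  obtain ⟨α, β, hj, -, h1, h2, h3⟩ := ω.exists_comp (a ++ [e]) b (by simp [hab])
  refine ⟨α, h1, ?_, ?_⟩
  · unfold Path.last
    rw [h2, endpointFrom_append]
    rfl
  · simp only [Path.length, h2, hab, List.length_append, List.length_cons, List.length_nil]
    omega

namespace IsNonunimodularModel

/-- A walk that stays strictly above its first vertex is either trivial, or an upward weak bridge
followed, after the last visit of the maximal height `u`, by a walk that stays strictly between
its first vertex and depth `u`. Iterating this produces bridges of strictly decreasing heights,
whence the product. -/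
theorem pathSum_slab_le (hm : IsNonunimodularModel Γ w) (o : V) (z : ℝ≥0∞) (lam : ℝ)
    (T : Finset ℝ) (N₀ : ℕ) (N : ℕ) (hN : N ≤ N₀) {h : V → V → ℝ} (hh : IsHeight Γ h)
    (hT : ∀ ω : G.Path, ω.first = o → ω.length ≤ N₀ → |h ω.first ω.last| ∈ T) (t : ℝ) :
    pathSum (pathWeight Γ w z lam) o (slab h t ∩ {ω | ω.length ≤ N}) ≤
      ∏ v ∈ T with v < t, (1 + bridgeMass (pathWeight Γ w z lam) o h v) := by
  have hzero : pathSum (pathWeight Γ w z lam) o {ω | ω.length = 0} = 1 := by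
    rw [← pow_mul_partitionFn, hm.partitionFn_zero, pow_zero, one_mul]
  induction N generalizing h t with
  | zero =>
    calc _ ≤ pathSum (pathWeight Γ w z lam) o {ω | ω.length = 0} :=
          pathSum_mono_set _ _ fun ω hω => Nat.le_zero.1 hω.2
      _ = 1 := hzero
      _ ≤ _ := Finset.one_le_prod' fun v _ => le_self_add
  | succ N ih =>
    set W := pathWeight Γ w z lam with hW
    let R : Option ↥{v ∈ T | v < t} → Set G.Path := fun i => i.elim {ω | ω.length = 0} fun u =>
      {ω | ∃ (α β : G.Path) (hab : α.last = β.first), ω = α.comp β hab ∧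
        α ∈ weakBridge h ∩ {ω | h ω.first ω.last = u} ∧ β ∈ slab (-h) u ∩ {ω | ω.length ≤ N}}
    have hcover := pathSum_iUnion_le W o (S := slab h t ∩ {ω | ω.length ≤ N + 1}) R (by
      rintro ω hωo ⟨⟨hω1, hω2⟩, hω3⟩
      obtain ⟨α, β, hab, rfl, hα, hβ⟩ := hh.exists_split ω
      have hlen : α.length + β.length ≤ N + 1 := by
        rw [← Path.length_comp α β hab]
        exact hω3
      by_cases hα0 : α.edges = []
      · -- The first step of `β` would lead both upwards and downwards.
        have hβ0 : β.edges = [] := by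
          by_contra hne
          obtain ⟨e, he⟩ := List.exists_mem_of_ne_nil _ hne
          have h1 := hω1 e (List.mem_append_right _ he)
          have h2 := hβ e he
          rw [Path.first_comp, ← Path.last_eq_first (ω := α) (by simp [Path.length, hα0]), hab]
            at h1
          simp only [Pi.neg_apply] at h2
          linarith
        exact ⟨none, by simp [R, Path.length, hα0, hβ0]⟩
      · have hu0 := hh.last_nonneg hα
        obtain ⟨e, he, he'⟩ := Path.exists_head_eq_last hα0
        have hut : h α.first α.last < t := by
          rw [← he']
          exact hω2 e (List.mem_append_left _ he)
        have huT : h α.first α.last ∈ T := by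
          have := hT α hωo (by omega)
          rwa [abs_of_nonneg hu0] at this
        have hα1 : 1 ≤ α.length := List.length_pos_of_ne_nil hα0
        refine ⟨some ⟨_, Finset.mem_filter.2 ⟨huT, hut⟩⟩, α, β, hab, rfl,
          ⟨⟨fun f hf => (hω1 f (List.mem_append_left _ hf)).le, hα⟩, rfl⟩, ⟨hβ, ?_⟩, ?_⟩
        · intro f hf
          have h1 := hω1 f (List.mem_append_right _ hf)
          have h2 := hh.add α.first α.last (G.head f)
          rw [Path.first_comp] at h1
          rw [← hab]
          simp only [Pi.neg_apply]
          linarith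
        · exact (by omega : β.length ≤ N))
    refine hcover.trans ?_
    rw [tsum_fintype, Fintype.sum_option, Finset.prod_add_ordered]
    simp only [Finset.prod_const_one, mul_one]
    refine add_le_add hzero.le ?_
    have hR : ∀ u : ↥{v ∈ T | v < t}, pathSum W o (R (some u)) ≤
        bridgeMass W o h u * ∏ v ∈ T with v < (u : ℝ), (1 + bridgeMass W o h v) := by
      intro u
      have hih := ih (Nat.le_of_succ_le hN) hh.neg (fun ω h1 h2 => by
        simpa [abs_neg] using hT ω h1 h2) u
      simp only [bridgeMass_neg] at hih
      calc pathSum W o (R (some u)) ≤ pathSum W o (weakBridge h ∩ {ω | h ω.first ω.last = u}) *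
            pathSum W o (slab (-h) u ∩ {ω | ω.length ≤ N}) :=
            pathSum_le_mul hm.transitive (hm.isInvariantWeight z lam) (hm.isRepulsiveWeight z lam)
              ((isInvariantSet_slab hh.neg u).inter (isInvariantSet_length (· ≤ N))) o
              fun ω _ hω => hω
        _ ≤ _ := mul_le_mul' le_self_add hih
    refine (Finset.sum_le_sum fun u _ => hR u).trans (le_of_eq ?_)
    rw [Finset.sum_coe_sort ({v ∈ T | v < t} : Finset ℝ) fun u =>
      bridgeMass W o h u * ∏ v ∈ T with v < u, (1 + bridgeMass W o h v)]
    refine Finset.sum_congr rfl fun u hu => ?_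
    have hut : u < t := (Finset.mem_filter.1 hu).2
    have hfilter : ({v ∈ ({v ∈ T | v < t} : Finset ℝ) | v < u} : Finset ℝ) =
        ({v ∈ T | v < u} : Finset ℝ) := by
      ext v
      simp only [Finset.mem_filter]
      exact ⟨fun hv => ⟨hv.1.1, hv.2⟩, fun hv => ⟨⟨hv.1, hv.2.trans hut⟩, hv.2⟩⟩
    rw [hfilter]

end IsNonunimodularModel

theorem _root_.ENNReal.prod_one_add_le_exp {ι : Type*} (s : Finset ι) (f : ι → ℝ≥0∞) {K : ℝ≥0∞}
    (hK : K ≠ ⊤) (h : ∑ i ∈ s, f i ≤ K) :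
    ∏ i ∈ s, (1 + f i) ≤ ENNReal.ofReal (Real.exp K.toReal) := by
  have hf : ∀ i ∈ s, f i ≠ ⊤ := ENNReal.sum_ne_top.1 (ne_top_of_le_ne_top hK h)
  calc ∏ i ∈ s, (1 + f i) ≤ ∏ i ∈ s, ENNReal.ofReal (Real.exp (f i).toReal) := by
        refine Finset.prod_le_prod' fun i hi => ?_
        rw [← ENNReal.ofReal_toReal (hf i hi), ← ENNReal.ofReal_one,
          ← ENNReal.ofReal_add zero_le_one ENNReal.toReal_nonneg,
          ENNReal.toReal_ofReal ENNReal.toReal_nonneg, add_comm]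
        exact ENNReal.ofReal_le_ofReal (Real.add_one_le_exp _)
    _ = ENNReal.ofReal (Real.exp (∑ i ∈ s, f i).toReal) := by
        rw [← ENNReal.ofReal_prod_of_nonneg fun _ _ => (Real.exp_pos _).le, ← Real.exp_sum,
          ENNReal.toReal_sum hf]
    _ ≤ _ := ENNReal.ofReal_le_ofReal (Real.exp_le_exp.2 (ENNReal.toReal_mono hK h))

namespace IsNonunimodularModel

theorem pathSum_strictlyAbove_lt_top (hm : IsNonunimodularModel Γ w) (o : V) (z : ℝ≥0∞) (lam : ℝ)
    {h : V → V → ℝ} (hh : IsHeight Γ h)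
    (h1 : pathSum (pathWeight Γ w z lam) o (weakBridge h) < ⊤)
    (h2 : pathSum (pathWeight Γ w z lam) o (weakBridge (-h)) < ⊤) :
    pathSum (pathWeight Γ w z lam) o (strictlyAbove h) < ⊤ := by
  set W := pathWeight Γ w z lam with hW
  set K := pathSum W o (weakBridge h) + pathSum W o (weakBridge (-h)) with hKdef
  have hK : K ≠ ⊤ := ENNReal.add_ne_top.2 ⟨h1.ne, h2.ne⟩
  have key : ∀ N : ℕ, pathSum W o (strictlyAbove h ∩ {ω | ω.length ≤ N}) ≤
      ENNReal.ofReal (Real.exp K.toReal) := by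
    intro N
    have hfin : (⋃ n ∈ Finset.range (N + 1), G.pathsFrom o n).Finite :=
      Set.Finite.biUnion (Finset.finite_toSet _) fun n _ => finite_pathsFrom hm.locallyFinite n o
    let T : Finset ℝ := (hfin.image fun ω => |h ω.first ω.last|).toFinset
    have hT : ∀ ω : G.Path, ω.first = o → ω.length ≤ N → |h ω.first ω.last| ∈ T := by
      intro ω hω1 hω2
      refine (Set.Finite.mem_toFinset _).2 ⟨ω, ?_, rfl⟩
      exact Set.mem_biUnion (Finset.mem_coe.2 (Finset.mem_range.2 (Nat.lt_succ_of_le hω2)))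
        ⟨hω1, rfl⟩
    obtain ⟨t, ht⟩ : ∃ t : ℝ, ∀ u ∈ T, u < t := by
      obtain ⟨t, ht⟩ := T.bddAbove
      exact ⟨t + 1, fun u hu => (ht hu).trans_lt (lt_add_one t)⟩
    refine le_trans (pathSum_le_of_injective id Function.injective_id ?_)
      ((hm.pathSum_slab_le o z lam T N N le_rfl hh hT t).trans
        (ENNReal.prod_one_add_le_exp _ _ hK (sum_bridgeMass_le W o h _)))
    rintro ω hωo ⟨hω1, hω2⟩
    refine ⟨hωo, ⟨⟨hω1, fun e he => ?_⟩, hω2⟩, le_rfl⟩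
    obtain ⟨α, hα1, hα2, hα3⟩ := Path.exists_initial_last_eq_head he
    have := ht _ (hT α (hα1.trans hωo) (hα3.trans hω2))
    rw [hα1, hα2] at this
    exact (le_abs_self _).trans_lt this
  rw [pathSum_eq_tsum_fiber W o (strictlyAbove h) Path.length]
  refine (ENNReal.tsum_le_of_sum_range_le fun N => ?_).trans_lt
    (ENNReal.ofReal_lt_top (r := Real.exp K.toReal))
  refine le_trans ?_ (key N)
  rw [pathSum_eq_tsum_fiber W o (strictlyAbove h ∩ _) Path.length]
  refine le_trans (Finset.sum_le_sum fun n hn => pathSum_mono_set W o ?_)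
    (ENNReal.sum_le_tsum (Finset.range N))
  rintro ω ⟨hω1, hω2⟩
  refine ⟨⟨hω1, ?_⟩, hω2⟩
  have hω3 : ω.length = n := hω2
  exact (by rw [hω3]; exact (Finset.mem_range.1 hn).le : ω.length ≤ N)

/-- The tilted susceptibility at `z_{c,lam}` is finite for every tilt strictly between `1 - lam` and
`lam`: there both upward and downward bridges decay exponentially in their height. -/
theorem susceptibility_zCrit_lt_top (hm : IsNonunimodularModel Γ w) (o : V) {lam lam' : ℝ}
    (h1 : 1 - lam < lam') (h2 : lam' < lam) :
    susceptibility Γ w o (zCrit Γ w o lam) lam' < ⊤ := by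
  have hh := hm.isHeight
  set z := zCrit Γ w o lam
  have hb : ∀ κ, 1 - lam < κ → κ < lam →
      pathSum (pathWeight Γ w z κ) o (weakBridge (height Γ)) < ⊤ ∧
        pathSum (pathWeight Γ w z κ) o (weakBridge (-height Γ)) < ⊤ := fun κ hκ1 hκ2 =>
    ⟨hm.pathSum_weakBridge_lt_top o hκ2, hm.pathSum_weakBridge_neg_lt_top o hκ1⟩
  have hbelow : pathSum (pathWeight Γ w z lam') o (strictlyAbove (-height Γ)) < ⊤ := by
    refine hm.pathSum_strictlyAbove_lt_top o z lam' hh.neg (hb lam' h1 h2).2 ?_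
    rw [neg_neg]
    exact (hb lam' h1 h2).1
  have h1' : 1 - lam < 1 - lam' := by linarith
  have h2' : 1 - lam' < lam := by linarith
  have hbelow' : pathSum (pathWeight Γ w z (1 - lam')) o (weaklyAbove (-height Γ)) < ⊤ := by
    refine lt_of_le_of_lt ?_ (ENNReal.mul_lt_top (hb _ h1' h2').2
      (hm.pathSum_strictlyAbove_lt_top o z (1 - lam') hh (hb _ h1' h2').1 (hb _ h1' h2').2))
    refine pathSum_le_mul hm.transitive (hm.isInvariantWeight z _) (hm.isRepulsiveWeight z _)
      (isInvariantSet_strictlyAbove hh) o ?_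
    intro ω _ hω
    obtain ⟨α, β, hab, rfl, hα, hβ⟩ := hh.neg.exists_split ω
    rw [neg_neg] at hβ
    exact ⟨α, β, hab, rfl, ⟨fun e he => hω e (List.mem_append_left _ he), hα⟩, hβ⟩
  have htop : pathSum (pathWeight Γ w z lam') o (endsAtTop (height Γ)) < ⊤ :=
    ((hm.pathSum_le_reverse z lam' o (isInvariantSet_endsAtTop hh)).trans
      (pathSum_mono_set _ _ (reverse_preimage_endsAtTop hh))).trans_lt hbelow'
  rw [susceptibility_eq_pathSum]
  refine lt_of_le_of_lt ?_ (ENNReal.mul_lt_top htop hbelow)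
  refine pathSum_le_mul hm.transitive (hm.isInvariantWeight z _) (hm.isRepulsiveWeight z _)
    (isInvariantSet_strictlyAbove hh.neg) o ?_
  intro ω _ _
  obtain ⟨α, β, hab, e, hα, hβ⟩ := hh.exists_split ω
  exact ⟨α, β, hab, e, hα, hβ⟩

theorem zCrit_lt_zCrit (hm : IsNonunimodularModel Γ w) (o : V) {lam lam' : ℝ}
    (h1 : 1 - lam < lam') (h2 : lam' < lam) : zCrit Γ w o lam < zCrit Γ w o lam' :=
  hm.lt_zCrit (hm.susceptibility_zCrit_lt_top o h1 h2)

end IsNonunimodularModel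

/-! ### Mean-field behaviour of the susceptibility -/

namespace IsNonunimodularModel

theorem zCrit_lt_zTilt (hm : IsNonunimodularModel Γ w) (o : V) {lam : ℝ} (hlam : lam ≠ 1 / 2) :
    zCrit Γ w o lam < zTilt Γ w o := by
  unfold zTilt
  rcases lt_or_gt_of_ne hlam with h | h
  · rw [← hm.zCrit_one_sub]
    exact hm.zCrit_lt_zCrit o (by linarith) (by linarith)
  · exact hm.zCrit_lt_zCrit o (by linarith) h

/-- A walk is cut at its last minimum and then at the last maximum of the remainder. The middle part
is a bridge, and bridges of given length have generating function at most one at `z_{c,lam}`. The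
outer parts do not increase the height, so that lowering the tilt to `1 / 2` increases their weight,
and the susceptibility with tilt `1 / 2` is finite at `z_{c,lam}`. -/
theorem exists_pow_mul_partitionFn_le_of_half_lt (hm : IsNonunimodularModel Γ w) (o : V) {lam : ℝ}
    (hlam : 1 / 2 < lam) :
    ∃ C : ℝ≥0, ∀ n, zCrit Γ w o lam ^ n * partitionFn Γ w o lam n ≤ C := by
  have hh := hm.isHeight
  set z := zCrit Γ w o lam with hz
  set h := height Γ with hdef
  set W := pathWeight Γ w z lam with hW
  let A : ℕ → Set G.Path := fun i => {ω | ω.length = i} ∩ {ω | h ω.first ω.last ≤ 0}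
  have hAinv : ∀ i, IsInvariantSet Γ (A i) := fun i =>
    (isInvariantSet_length (· = i)).inter (isInvariantSet_height hh (· ≤ 0))
  have hA : ∑' i, pathSum W o (A i) < ⊤ := by
    refine lt_of_le_of_lt (ENNReal.tsum_le_tsum fun i => ?_)
      (hm.susceptibility_zCrit_lt_top o (lam := lam) (lam' := 1 / 2) (by linarith) hlam)
    rw [pow_mul_partitionFn]
    refine le_trans (pathSum_mono (W' := pathWeight Γ w z (1 / 2)) fun ω _ hω => ?_)
      (pathSum_mono_set _ _ Set.inter_subset_left)
    have h0 : h ω.first ω.last ≤ 0 := hω.2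
    have h1 := hm.pathWeight_le_tilt z (lam := 1 / 2) (lam' := lam) (c := 0) (ω := ω)
      (mul_nonpos_of_nonneg_of_nonpos (by linarith) h0)
    simpa using h1
  have hlast : ∀ α : G.Path, α ∈ endsAtTop (-h) → h α.first α.last ≤ 0 := fun α hα => by
    simpa using hh.neg.last_nonneg hα
  have hbridge : ∀ j, pathSum W o ((strictlyAbove h ∩ endsAtTop h) ∩ {ω | ω.length = j}) ≤ 1 := by
    intro j
    refine hm.pathSum_bridge_le_one hh o lam ?_ (fun ω hω => hω.1.1) (fun ω hω => hω.1.2) ?_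
    · exact ((isInvariantSet_strictlyAbove hh).inter (isInvariantSet_endsAtTop hh)).inter
        (isInvariantSet_length (· = j))
    · intro α α' _ _ hα hα' _ _ _ _
      exact Eq.trans hα.2 (Eq.symm hα'.2)
  have hB : ∀ m, pathSum W o (strictlyAbove h ∩ {ω | ω.length = m}) ≤ ∑' k, pathSum W o (A k) := by
    intro m
    refine (pathSum_iUnion_le W o (fun k => {ω | ∃ (α β : G.Path) (hab : α.last = β.first),
      ω = α.comp β hab ∧ α ∈ (strictlyAbove h ∩ endsAtTop h) ∩ {ω | ω.length = m - k} ∧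
        β ∈ A k}) ?_).trans (ENNReal.tsum_le_tsum fun k => ?_)
    · rintro ω - ⟨hω1, hω2⟩
      obtain ⟨α, β, hab, rfl, hα, hβ⟩ := hh.exists_split ω
      have hlen : α.length + β.length = m := by
        rw [← Path.length_comp α β hab]
        exact hω2
      refine ⟨β.length, α, β, hab, rfl, ⟨⟨fun e he => hω1 e (List.mem_append_left _ he), hα⟩,
        (by omega : α.length = m - β.length)⟩, rfl, ?_⟩
      rcases eq_or_ne β.edges [] with hne | hne
      · rw [Set.mem_ofPred_eq, Path.last_eq_first (by simp [Path.length, hne]), hh.self]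
      · obtain ⟨e, he, he'⟩ := Path.exists_head_eq_last hne
        have := hβ e he
        rw [he'] at this
        simpa using this.le
    · refine (pathSum_le_mul hm.transitive (hm.isInvariantWeight z lam)
        (hm.isRepulsiveWeight z lam) (hAinv k) o fun ω _ hω => hω).trans ?_
      exact (mul_le_mul_left (hbridge _) _).trans (one_mul _).le
  refine ⟨((∑' i, pathSum W o (A i)) * ∑' i, pathSum W o (A i)).toNNReal, fun n => ?_⟩
  rw [ENNReal.coe_toNNReal (ENNReal.mul_lt_top hA hA).ne, pow_mul_partitionFn,
    ← ENNReal.tsum_mul_right]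
  refine (pathSum_iUnion_le W o (fun i => {ω | ∃ (α β : G.Path) (hab : α.last = β.first),
      ω = α.comp β hab ∧ α ∈ A i ∧ β ∈ strictlyAbove h ∩ {ω | ω.length = n - i}}) ?_).trans
    (ENNReal.tsum_le_tsum fun i => ?_)
  · intro ω _ hω
    obtain ⟨α, β, hab, rfl, hα, hβ⟩ := hh.neg.exists_split ω
    rw [neg_neg] at hβ
    have hlen : α.length + β.length = n := by
      rw [← Path.length_comp α β hab]
      exact hω
    exact ⟨α.length, α, β, hab, rfl, ⟨rfl, hlast α hα⟩, hβ,
      (by omega : β.length = n - α.length)⟩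
  · refine (pathSum_le_mul hm.transitive (hm.isInvariantWeight z lam)
      (hm.isRepulsiveWeight z lam) ((isInvariantSet_strictlyAbove hh).inter
        (isInvariantSet_length (· = n - i))) o fun ω _ hω => hω).trans ?_
    exact mul_le_mul_right (hB _) _

theorem exists_pow_mul_partitionFn_le (hm : IsNonunimodularModel Γ w) (o : V) {lam : ℝ}
    (hlam : lam ≠ 1 / 2) :
    ∃ C : ℝ≥0, ∀ n, zCrit Γ w o lam ^ n * partitionFn Γ w o lam n ≤ C := by
  rcases lt_or_gt_of_ne hlam with h | h
  · obtain ⟨C, hC⟩ := hm.exists_pow_mul_partitionFn_le_of_half_lt o (lam := 1 - lam) (by linarith)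
    simp only [hm.zCrit_one_sub, hm.partitionFn_one_sub] at hC
    exact ⟨C, hC⟩
  · exact hm.exists_pow_mul_partitionFn_le_of_half_lt o h

theorem muCrit_pow_le (hm : IsNonunimodularModel Γ w) (o : V) (lam : ℝ) (n : ℕ) :
    muCrit Γ w o lam ^ n ≤ partitionFn Γ w o lam n := by
  unfold muCrit
  rw [← ENNReal.inv_pow]
  refine (ENNReal.inv_le_iff_le_mul (fun _ => ?_) (fun h => ?_)).2
    (hm.one_le_zCrit_pow_mul o lam n)
  · exact pow_ne_zero _ (hm.zCrit_pos o lam).ne'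
  · exact absurd h (ENNReal.pow_ne_top (hm.zCrit_ne_top o lam))

theorem partitionFn_le_muCrit_pow (hm : IsNonunimodularModel Γ w) (o : V) {lam : ℝ} {C : ℝ≥0∞}
    {n : ℕ} (h : zCrit Γ w o lam ^ n * partitionFn Γ w o lam n ≤ C) :
    partitionFn Γ w o lam n ≤ C * muCrit Γ w o lam ^ n := by
  unfold muCrit
  rw [← ENNReal.inv_pow, ← div_eq_mul_inv, ENNReal.le_div_iff_mul_le
    (Or.inl (pow_ne_zero _ (hm.zCrit_pos o lam).ne'))
    (Or.inl (ENNReal.pow_ne_top (hm.zCrit_ne_top o lam))), mul_comm]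
  exact h

theorem tsum_pow_mul_muCrit_pow (hm : IsNonunimodularModel Γ w) (o : V) (lam : ℝ) (z : ℝ≥0∞) :
    ∑' n : ℕ, z ^ n * muCrit Γ w o lam ^ n = zCrit Γ w o lam / (zCrit Γ w o lam - z) := by
  have h0 := (hm.zCrit_pos o lam).ne'
  have h1 := hm.zCrit_ne_top o lam
  have h2 : zCrit Γ w o lam - z = zCrit Γ w o lam * (1 - z * muCrit Γ w o lam) := by
    rw [ENNReal.mul_sub (fun _ _ => h1), mul_one, mul_left_comm, muCrit,
      ENNReal.mul_inv_cancel h0 h1, mul_one]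
  simp only [← mul_pow]
  rw [ENNReal.tsum_geometric, h2, div_eq_mul_inv, ENNReal.mul_inv (Or.inl h0) (Or.inl h1),
    ← mul_assoc, ENNReal.mul_inv_cancel h0 h1, one_mul]

theorem exists_mean_field (hm : IsNonunimodularModel Γ w) (o : V) {lam : ℝ} (hlam : lam ≠ 1 / 2) :
    ∃ C : ℝ≥0, 0 < C ∧
      (∀ z : ℝ≥0∞, 0 < z → z < zCrit Γ w o lam →
        zCrit Γ w o lam / (zCrit Γ w o lam - z) ≤ susceptibility Γ w o z lam ∧
        susceptibility Γ w o z lam ≤ C * (zCrit Γ w o lam / (zCrit Γ w o lam - z))) ∧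
      (∀ n : ℕ, muCrit Γ w o lam ^ n ≤ partitionFn Γ w o lam n ∧
        partitionFn Γ w o lam n ≤ C * muCrit Γ w o lam ^ n) := by
  obtain ⟨C, hC⟩ := hm.exists_pow_mul_partitionFn_le o hlam
  have hup : ∀ n, partitionFn Γ w o lam n ≤ ((C + 1 : ℝ≥0) : ℝ≥0∞) * muCrit Γ w o lam ^ n :=
    fun n => hm.partitionFn_le_muCrit_pow o
      ((hC n).trans (ENNReal.coe_le_coe.2 (le_add_of_nonneg_right zero_le_one)))
  refine ⟨C + 1, by positivity, fun z _ _ => ?_, fun n => ⟨hm.muCrit_pow_le o lam n, hup n⟩⟩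
  rw [← hm.tsum_pow_mul_muCrit_pow o lam z, ← ENNReal.tsum_mul_left]
  constructor
  · exact ENNReal.tsum_le_tsum fun n => mul_le_mul_right (hm.muCrit_pow_le o lam n) _
  · refine ENNReal.tsum_le_tsum fun n => ?_
    rw [mul_left_comm]
    exact mul_le_mul_right (hup n) _

end IsNonunimodularModel

/-! ### Decay of the two-point function -/

theorem dist_le_length (ω : G.Path) : G.dist ω.first ω.last ≤ ω.length :=
  Nat.sInf_le ⟨ω, rfl, rfl, rfl⟩

theorem exists_length_eq_dist (hconn : G.IsConnected) (x y : V) :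
    ∃ ω : G.Path, ω.first = x ∧ ω.last = y ∧ ω.length = G.dist x y := by
  obtain ⟨ω, h1, h2⟩ := hconn x y
  exact Nat.sInf_mem (s := {n : ℕ | ∃ ω : G.Path, ω.first = x ∧ ω.last = y ∧ ω.length = n})
    ⟨ω.length, ω, h1, h2, rfl⟩

namespace IsNonunimodularModel

/-- The two-point function at `x` is compared with the susceptibility with tilt `1 / 2`. If
`Δ(o, x) < 1`, the paths are reversed and moved back to `o` first, which replaces `x` by a vertex at
the inverse modular distance without changing lengths and weights. -/
theorem twoPoint_le (hm : IsNonunimodularModel Γ w) (o x : V) {z z' : ℝ≥0∞} {q : ℝ≥0∞}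
    (hq : q ≤ 1) (hz : z ≤ q * z') :
    twoPoint w o z x ≤ q ^ G.dist o x * susceptibility Γ w o z' (1 / 2) := by
  have := hm.transitive
  have hweight : ∀ ω : G.Path, G.dist o x ≤ ω.length → 1 ≤ modular Γ ω.first ω.last →
      (w ω : ℝ≥0∞) * z ^ ω.length ≤ q ^ G.dist o x * pathWeight Γ w z' (1 / 2) ω := by
    intro ω h1 h2
    have h3 : w ω ≤ w ω * modular Γ ω.first ω.last ^ (1 / 2 : ℝ) :=
      le_mul_of_one_le_right zero_le (NNReal.one_le_rpow h2 (by norm_num))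
    calc (w ω : ℝ≥0∞) * z ^ ω.length ≤ w ω * (q * z') ^ ω.length := by gcongr
      _ = q ^ ω.length * (z' ^ ω.length * w ω) := by ring
      _ ≤ _ := mul_le_mul' (pow_le_pow_right_of_le_one' hq h1)
        (mul_le_mul_right (ENNReal.coe_le_coe.2 h3) _)
  have hdist : ∀ ω : G.Path, ω.first = o → ω.last = x → G.dist o x ≤ ω.length := by
    rintro ω rfl rfl
    exact dist_le_length ω
  rw [susceptibility_eq_pathSum, ← pathSum_const_mul]
  change pathSum (fun ω => (w ω : ℝ≥0∞) * z ^ ω.length) o {ω | ω.last = x} ≤ _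
  rcases le_or_gt 1 (modular Γ o x) with h | h
  · refine pathSum_le_of_injective id Function.injective_id fun ω h1 h2 =>
      ⟨h1, Set.mem_univ _, hweight ω (hdist ω h1 h2) ?_⟩
    rwa [h1, show ω.last = x from h2]
  · obtain ⟨γ, hγ⟩ := MulAction.exists_smul_eq Γ x o
    refine pathSum_le_of_injective (fun ω => ω.reverse.map γ.1)
      ((Path.map_injective _).comp Path.reverse_injective) fun ω h1 h2 => ?_
    have hfirst : (ω.reverse.map γ.1).first = o := by
      rw [Path.first_map, Path.first_reverse, show ω.last = x from h2]
      exact hγ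
    refine ⟨hfirst, Set.mem_univ _, ?_⟩
    have hlen : (ω.reverse.map γ.1).length = ω.length := by
      rw [Path.length_map, Path.length_reverse]
    have hw : w (ω.reverse.map γ.1) = w ω := by
      rw [hm.good.invariant γ.1 γ.2, hm.good.reversible]
    have hle := hweight (ω.reverse.map γ.1) (hlen ▸ hdist ω h1 h2) (by
      have h3 : modular Γ (γ.1 • x) (γ.1 • o) = modular Γ x o := modular_smul γ x o
      rw [Path.first_map, Path.last_map, Path.first_reverse, Path.last_reverse, h1,
        show ω.last = x from h2, h3, modular_swap hm.connected hm.locallyFinite]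
      exact (one_le_inv₀ (modular_pos hm.connected hm.locallyFinite _ _)).2 h.le)
    rwa [hlen, hw] at hle

theorem exists_twoPoint_le (hm : IsNonunimodularModel Γ w) (o : V) {z : ℝ≥0∞}
    (hz : z < zTilt Γ w o) :
    ∃ C c : ℝ, 0 < C ∧ 0 < c ∧ ∀ x : V,
      twoPoint w o z x ≤ ENNReal.ofReal (C * Real.exp (-c * (G.dist o x : ℝ))) := by
  obtain ⟨z', hz1, hz2⟩ := exists_between hz
  obtain ⟨z'', hz3, hz4⟩ := exists_between hz1
  have hz'top : z' ≠ ⊤ := hz2.ne_top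
  have hz'0 : z' ≠ 0 := (hz1.trans_le' (zero_le)).ne'
  have hz''0 : z'' ≠ 0 := (hz3.trans_le' (zero_le)).ne'
  have hq1 : z'' / z' < 1 := ENNReal.div_lt_of_lt_mul (by rwa [one_mul])
  have hq0 : 0 < (z'' / z').toReal :=
    ENNReal.toReal_pos (ENNReal.div_pos hz''0 hz'top).ne' hq1.ne_top
  have hK := (susceptibility_lt_top (Γ := Γ) (w := w) (o := o) (lam := 1 / 2) hz2).ne
  refine ⟨(susceptibility Γ w o z' (1 / 2)).toReal + 1, -Real.log (z'' / z').toReal,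
    by positivity, ?_, fun x => ?_⟩
  · rw [neg_pos]
    refine Real.log_neg hq0 ?_
    rw [← ENNReal.toReal_one]
    exact (ENNReal.toReal_lt_toReal hq1.ne_top ENNReal.one_ne_top).2 hq1
  · have hexp : Real.exp (-(-Real.log (z'' / z').toReal) * (G.dist o x : ℝ)) =
        (z'' / z').toReal ^ G.dist o x := by
      rw [neg_neg, mul_comm, Real.exp_nat_mul, Real.exp_log hq0]
    rw [hexp]
    calc twoPoint w o z x ≤ (z'' / z') ^ G.dist o x * susceptibility Γ w o z' (1 / 2) :=
          hm.twoPoint_le o x hq1.le (by rw [ENNReal.div_mul_cancel hz'0 hz'top]; exact hz3.le)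
      _ = ENNReal.ofReal ((susceptibility Γ w o z' (1 / 2)).toReal *
          (z'' / z').toReal ^ G.dist o x) := by
        rw [ENNReal.ofReal_mul ENNReal.toReal_nonneg, ENNReal.ofReal_toReal hK,
          ENNReal.ofReal_pow hq0.le, ENNReal.ofReal_toReal hq1.ne_top, mul_comm]
      _ ≤ _ := by
        apply ENNReal.ofReal_le_ofReal
        gcongr
        linarith

end IsNonunimodularModel

/-! ### Linear growth of height and distance -/

theorem tiltedMeasure_apply (o : V) (lam : ℝ) (n : ℕ) (S : Set G.Path) :
    tiltedMeasure Γ w o lam n S = (partitionFn Γ w o lam n)⁻¹ *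
      pathSum (pathWeight Γ w 1 lam) o (S ∩ {ω | ω.length = n}) := by
  classical
  have hS : MeasurableSet S := trivial
  unfold tiltedMeasure pathSum
  rw [MeasureTheory.Measure.sum_apply _ hS, ← ENNReal.tsum_mul_left]
  simp only [MeasureTheory.Measure.smul_apply, smul_eq_mul,
    MeasureTheory.Measure.dirac_apply' _ hS]
  rw [tsum_subtype (G.pathsFrom o n) fun ω => (partitionFn Γ w o lam n)⁻¹ *
      (tiltedWeight Γ w o lam ω : ℝ≥0∞) * S.indicator 1 ω,
    tsum_subtype ({ω : G.Path | ω.first = o} ∩ (S ∩ {ω | ω.length = n})) fun ω =>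
      (partitionFn Γ w o lam n)⁻¹ * pathWeight Γ w 1 lam ω]
  refine tsum_congr fun ω => ?_
  by_cases h1 : ω.first = o <;> by_cases h2 : ω.length = n <;> by_cases h3 : ω ∈ S <;>
    simp [Set.indicator_apply, pathsFrom, h1, h2, h3, pathWeight, tiltedWeight]

namespace IsNonunimodularModel

theorem partitionFn_ne_zero (hm : IsNonunimodularModel Γ w) (o : V) (lam : ℝ) (n : ℕ) :
    partitionFn Γ w o lam n ≠ 0 := by
  intro h
  have := hm.one_le_zCrit_pow_mul o lam n
  rw [h, mul_zero] at this
  exact absurd this (not_le.2 zero_lt_one)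

theorem tiltedMeasure_add_compl (hm : IsNonunimodularModel Γ w) (o : V) (lam : ℝ) (n : ℕ)
    (S : Set G.Path) :
    tiltedMeasure Γ w o lam n S + tiltedMeasure Γ w o lam n Sᶜ = 1 := by
  have hS : MeasurableSet S := trivial
  rw [MeasureTheory.measure_add_measure_compl hS, tiltedMeasure_apply, Set.univ_inter,
    ← pow_mul_partitionFn, one_pow, one_mul]
  exact ENNReal.inv_mul_cancel (hm.partitionFn_ne_zero o lam n) (hm.partitionFn_ne_top o lam n)

theorem partitionFn_le_pow (hm : IsNonunimodularModel Γ w) (o : V) (lam : ℝ) (n : ℕ) :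
    partitionFn Γ w o lam n ≤ partitionFn Γ w o lam 1 ^ n := by
  induction n with
  | zero => rw [hm.partitionFn_zero, pow_zero]
  | succ n ih =>
    rw [pow_succ]
    exact (hm.partitionFn_add_le o lam n 1).trans (mul_le_mul_left ih _)

/-- The modular function grows at most exponentially in the distance. -/
theorem exists_abs_height_le (hm : IsNonunimodularModel Γ w) :
    ∃ t : ℝ, 0 < t ∧ ∀ x y : V, |height Γ x y| ≤ t * G.dist x y := by
  have hh := hm.isHeight
  have := hm.transitive
  obtain ⟨t, ht0, ht⟩ : ∃ t : ℝ, 0 < t ∧ ∀ e : E, |height Γ (G.tail e) (G.head e)| ≤ t := by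
    rcases isEmpty_or_nonempty V with hV | ⟨⟨o⟩⟩
    · exact ⟨1, one_pos, fun e => (hV.false (G.tail e)).elim⟩
    · obtain ⟨t, ht⟩ := ((hm.locallyFinite o).image fun e =>
        |height Γ (G.tail e) (G.head e)|).bddAbove
      refine ⟨max t 1, by positivity, fun e => le_max_of_le_left ?_⟩
      obtain ⟨γ, hγ⟩ := MulAction.exists_smul_eq Γ (G.tail e) o
      have h1 : height Γ (γ.1 • G.tail e) (γ.1 • G.head e) = height Γ (G.tail e) (G.head e) :=
        hh.smul γ _ _
      refine ht ⟨γ.1.1.2 e, (tail_smul _ _).trans hγ, ?_⟩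
      simp only
      rw [tail_smul, head_smul]
      exact congrArg _ h1
  have key : ∀ (l : List E) (v : V), G.IsPathFrom v l →
      |height Γ v (G.endpointFrom v l)| ≤ t * l.length := by
    intro l
    induction l with
    | nil =>
      intro v _
      simp [endpointFrom, hh.self]
    | cons e l ih =>
      intro v hl
      have h1 := ht e
      rw [hl.1] at h1
      have h2 := ih _ hl.2
      have h3 := hh.add v (G.head e) (G.endpointFrom (G.head e) l)
      have h4 := abs_add_le (height Γ v (G.head e))
        (height Γ (G.head e) (G.endpointFrom (G.head e) l))
      rw [h3] at h4
      simp only [endpointFrom, List.length_cons]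
      push_cast
      linarith
  refine ⟨t, ht0, fun x y => ?_⟩
  obtain ⟨ω, rfl, rfl, h⟩ := exists_length_eq_dist hm.connected x y
  rw [← h]
  exact key ω.edges ω.first ω.isPath

end IsNonunimodularModel

/-- A rate `c` such that `1 - exp (-c n)` is a lower bound both for `1 - K exp (-b n)` when `n` is
large and for `p ^ n` when `n` is small. -/
theorem exists_rate {b K p : ℝ} (hb : 0 < b) (hp : 0 < p) (hp1 : p ≤ 1) :
    ∃ c₀ : ℝ, 0 < c₀ ∧ ∀ c, c ≤ c₀ → ∀ n : ℕ,
      K * Real.exp (-b * n) ≤ Real.exp (-c * n) ∨ 1 - Real.exp (-c * n) ≤ p ^ n := by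
  have hlim : Filter.Tendsto (fun n : ℕ => K * Real.exp (-(b / 2)) ^ n) Filter.atTop (nhds 0) := by
    have := (tendsto_pow_atTop_nhds_zero_of_lt_one (Real.exp_pos (-(b / 2))).le
      (Real.exp_lt_one_iff.2 (by linarith))).const_mul K
    rwa [mul_zero] at this
  obtain ⟨N, hN⟩ := Filter.eventually_atTop.1 (hlim.eventually (ge_mem_nhds one_pos))
  refine ⟨min (b / 2) (p ^ N / (N + 1)), by positivity, fun c hc n => ?_⟩
  have hc1 := hc.trans (min_le_left _ _)
  have hc2 := hc.trans (min_le_right _ _)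
  rcases le_or_gt N n with hn | hn
  · left
    have h1 := hN n hn
    rw [← Real.exp_nat_mul] at h1
    have h2 : Real.exp (-b * n) = Real.exp (n * -(b / 2)) * Real.exp (n * -(b / 2)) := by
      rw [← Real.exp_add]
      ring_nf
    rw [h2, ← mul_assoc]
    refine (mul_le_of_le_one_left (Real.exp_pos _).le h1).trans (Real.exp_le_exp.2 ?_)
    nlinarith [mul_le_mul_of_nonneg_right hc1 (Nat.cast_nonneg (α := ℝ) n)]
  · right
    rw [le_div_iff₀ (by positivity)] at hc2
    have h1 := Real.add_one_le_exp (-c * n)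
    have h2 : p ^ N ≤ p ^ n := pow_le_pow_of_le_one hp.le hp1 hn.le
    have h3 : (n : ℝ) ≤ N := by exact_mod_cast hn.le
    rcases le_or_gt c 0 with h0 | h0
    · have := pow_pos hp n
      nlinarith [mul_nonneg (neg_nonneg.2 h0) (Nat.cast_nonneg (α := ℝ) n)]
    · nlinarith [mul_le_mul_of_nonneg_left h3 h0.le]

namespace IsNonunimodularModel

/-- A walk that climbs less than `c * n` in the direction favoured by the tilt has, up to a factor
`exp (|lam - 1 / 2| * c * n)`, at most the weight that it has with tilt `1 / 2`; and
`Z_w(1 / 2; n)` is exponentially smaller than `Z_w(lam; n)`. -/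
theorem exists_tiltedMeasure_le (hm : IsNonunimodularModel Γ w) (o : V) {lam σ : ℝ}
    (hσ : σ * (lam - 1 / 2) = |lam - 1 / 2|) (hσ1 : σ * σ = 1) (hlam : lam ≠ 1 / 2) :
    ∃ b K c₁ : ℝ, 0 < b ∧ 0 < c₁ ∧ ∀ c ≤ c₁, ∀ n : ℕ,
      tiltedMeasure Γ w o lam n {ω | c * n ≤ σ * Real.log (modular Γ o ω.last : ℝ)}ᶜ ≤
        ENNReal.ofReal (K * Real.exp (-b * n)) := by
  set δ := |lam - 1 / 2| with hδ
  have hδ0 : 0 < δ := abs_pos.2 (sub_ne_zero.2 hlam)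
  obtain ⟨z, hz1, hz2⟩ := exists_between (hm.zCrit_lt_zTilt o hlam)
  set zc := zCrit Γ w o lam with hzc
  have hzc0 := (hm.zCrit_pos o lam).ne'
  have hz0 : z ≠ 0 := (hz1.trans_le' zero_le).ne'
  have hztop : z ≠ ⊤ := hz2.ne_top
  have hq1 : zc / z < 1 := ENNReal.div_lt_of_lt_mul (by rwa [one_mul])
  have hq0 : 0 < (zc / z).toReal :=
    ENNReal.toReal_pos (ENNReal.div_pos hzc0 hztop).ne' hq1.ne_top
  have hK := (susceptibility_lt_top (Γ := Γ) (w := w) (o := o) (lam := 1 / 2) hz2).ne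
  set K := susceptibility Γ w o z (1 / 2) with hKdef
  have hlog : Real.log (zc / z).toReal < 0 := by
    refine Real.log_neg hq0 ?_
    rw [← ENNReal.toReal_one]
    exact (ENNReal.toReal_lt_toReal hq1.ne_top ENNReal.one_ne_top).2 hq1
  -- Half of the exponential gain pays for the change of tilt.
  refine ⟨-Real.log (zc / z).toReal / 2, K.toReal, -Real.log (zc / z).toReal / (2 * δ),
    by linarith, div_pos (by linarith) (by positivity), fun c hc n => ?_⟩
  have hδc : δ * c ≤ -Real.log (zc / z).toReal / 2 := by
    rw [le_div_iff₀ (by positivity)] at hc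
    linarith
  rw [tiltedMeasure_apply]
  have h1 : pathSum (pathWeight Γ w 1 lam) o
      ({ω | c * n ≤ σ * Real.log (modular Γ o ω.last : ℝ)}ᶜ ∩ {ω | ω.length = n}) ≤
      ENNReal.ofReal (Real.exp (δ * c * n)) * partitionFn Γ w o (1 / 2) n := by
    have h0 := pow_mul_partitionFn (Γ := Γ) (w := w) o 1 (1 / 2) n
    rw [one_pow, one_mul] at h0
    rw [h0, ← pathSum_const_mul]
    refine (pathSum_mono fun ω h1 hω => ?_).trans (pathSum_mono_set _ _ Set.inter_subset_right)
    refine hm.pathWeight_le_tilt 1 ?_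
    have h2 : σ * height Γ ω.first ω.last < c * n := by
      rw [h1]
      exact not_le.1 hω.1
    have h3 : (lam - 1 / 2) * height Γ ω.first ω.last =
        δ * (σ * height Γ ω.first ω.last) := by
      rw [← hσ]
      linear_combination (-(lam - 1 / 2) * height Γ ω.first ω.last) * hσ1
    rw [h3, mul_assoc]
    exact mul_le_mul_of_nonneg_left h2.le hδ0.le
  have h2 : z ^ n * partitionFn Γ w o (1 / 2) n ≤ K := ENNReal.le_tsum n
  have h3 : (partitionFn Γ w o lam n)⁻¹ ≤ zc ^ n := by
    rw [ENNReal.inv_le_iff_le_mul (fun _ => hm.partitionFn_ne_zero o lam n)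
      (fun h => absurd h (hm.partitionFn_ne_top o lam n)), mul_comm]
    exact hm.one_le_zCrit_pow_mul o lam n
  have h4 : zc = (zc / z) * z := (ENNReal.div_mul_cancel hz0 hztop).symm
  calc _ ≤ zc ^ n * (ENNReal.ofReal (Real.exp (δ * c * n)) * partitionFn Γ w o (1 / 2) n) :=
        mul_le_mul' h3 h1
    _ = (zc / z) ^ n * ENNReal.ofReal (Real.exp (δ * c * n)) *
        (z ^ n * partitionFn Γ w o (1 / 2) n) := by
      conv_lhs => rw [h4, mul_pow]
      ring
    _ ≤ (zc / z) ^ n * ENNReal.ofReal (Real.exp (δ * c * n)) * K := mul_le_mul_right h2 _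
    _ = ENNReal.ofReal (K.toReal * ((zc / z).toReal ^ n * Real.exp (δ * c * n))) := by
      rw [ENNReal.ofReal_mul ENNReal.toReal_nonneg, ENNReal.ofReal_toReal hK,
        ENNReal.ofReal_mul (by positivity), ENNReal.ofReal_pow hq0.le,
        ENNReal.ofReal_toReal hq1.ne_top, mul_comm]
    _ ≤ _ := by
      apply ENNReal.ofReal_le_ofReal
      refine mul_le_mul_of_nonneg_left ?_ ENNReal.toReal_nonneg
      rw [← Real.exp_log hq0, ← Real.exp_nat_mul, ← Real.exp_add, Real.log_exp]
      apply Real.exp_le_exp.2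
      nlinarith [mul_le_mul_of_nonneg_right hδc (Nat.cast_nonneg (α := ℝ) n)]

/-- The walk that takes only steps in the direction favoured by the tilt has probability at least
`p ^ n`. -/
theorem exists_pow_le_tiltedMeasure (hm : IsNonunimodularModel Γ w) (o : V) (lam : ℝ) {σ : ℝ}
    (hσ : σ = 1 ∨ σ = -1) :
    ∃ p s : ℝ, 0 < p ∧ p ≤ 1 ∧ 0 < s ∧ ∀ c ≤ s, ∀ n : ℕ, ENNReal.ofReal (p ^ n) ≤
      tiltedMeasure Γ w o lam n {ω | c * n ≤ σ * Real.log (modular Γ o ω.last : ℝ)} := by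
  obtain ⟨r, hr0, hr1, hs, hr⟩ : ∃ r : ℝ≥0, 0 < r ∧ r ≠ 1 ∧ 0 < σ * Real.log r ∧
      ∀ v, ∃ e : E, G.tail e = v ∧ modular Γ v (G.head e) = r := by
    obtain ⟨r, hr, h1, h2⟩ := hm.exists_steps
    have hlog : 0 < Real.log r := Real.log_pos (by exact_mod_cast hr)
    rcases hσ with rfl | rfl
    · exact ⟨r, zero_lt_one.trans hr, hr.ne', by linarith, h1⟩
    · refine ⟨r⁻¹, inv_pos.2 (zero_lt_one.trans hr), (inv_lt_one_of_one_lt₀ hr).ne, ?_, h2⟩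
      rw [NNReal.coe_inv, Real.log_inv]
      linarith
  set Z := partitionFn Γ w o lam 1 with hZ
  set ρ : ℝ≥0∞ := ((r ^ lam : ℝ≥0) : ℝ≥0∞) with hρ
  have hρ0 : ρ ≠ 0 := ENNReal.coe_ne_zero.2 (NNReal.rpow_pos hr0).ne'
  have hZ0 := hm.partitionFn_ne_zero o lam 1
  have hZt := hm.partitionFn_ne_top o lam 1
  have hρZ : ρ / Z ≤ 1 := by
    refine ENNReal.div_le_of_le_mul ?_
    have := hm.pow_le_partitionFn o lam hr1 hr 1
    rwa [pow_one, ← one_mul (partitionFn _ _ _ _ _)] at this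
  have hpt : ρ / Z ≠ ⊤ := ne_top_of_le_ne_top ENNReal.one_ne_top hρZ
  refine ⟨(ρ / Z).toReal, σ * Real.log r, ENNReal.toReal_pos (ENNReal.div_pos hρ0 hZt).ne' hpt,
    ?_, hs, fun c hc n => ?_⟩
  · rw [← ENNReal.toReal_one]
    exact ENNReal.toReal_mono ENNReal.one_ne_top hρZ
  · obtain ⟨ω, h1, h2, h3, h4, -⟩ := hm.exists_chain hr1 hr n o
    rw [← ENNReal.toReal_pow, ENNReal.ofReal_toReal (ENNReal.pow_ne_top hpt), tiltedMeasure_apply,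
      div_eq_mul_inv, mul_pow, mul_comm]
    refine mul_le_mul' ?_ ?_
    · rw [← ENNReal.inv_pow]
      exact ENNReal.inv_le_inv.2 (hm.partitionFn_le_pow o lam n)
    · refine le_trans ?_ (ENNReal.le_tsum (⟨ω, h1, ?_, h2⟩ : ↥({ω : G.Path | ω.first = o} ∩
        ({ω | c * n ≤ σ * Real.log (modular Γ o ω.last : ℝ)} ∩ {ω | ω.length = n}))))
      · rw [pathWeight, one_pow, one_mul, h1, h4, ← ENNReal.coe_pow, ENNReal.coe_le_coe,
          ← NNReal.rpow_natCast, ← NNReal.rpow_natCast, ← NNReal.rpow_mul, ← NNReal.rpow_mul,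
          mul_comm lam]
        exact le_mul_of_one_le_left zero_le h3
      · rw [Set.mem_ofPred_eq, h4, NNReal.coe_pow, Real.log_pow]
        nlinarith [mul_le_mul_of_nonneg_right hc (Nat.cast_nonneg (α := ℝ) n)]

theorem exists_linear_growth (hm : IsNonunimodularModel Γ w) (o : V) {lam : ℝ}
    (hlam : lam ≠ 1 / 2) :
    ∃ c c' : ℝ, 0 < c ∧ 0 < c' ∧
      (∀ n : ℕ, 1 - ENNReal.ofReal (Real.exp (-c * n)) ≤
        tiltedMeasure Γ w o lam n {ω | c * n ≤ Real.sign (lam - 1 / 2) *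
          Real.log (modular Γ o ω.last : ℝ)}) ∧
      (∀ n : ℕ, 1 - ENNReal.ofReal (Real.exp (-c' * n)) ≤
        tiltedMeasure Γ w o lam n {ω | c' * n ≤ (G.dist o ω.last : ℝ)}) := by
  set σ := Real.sign (lam - 1 / 2) with hσdef
  have hσ : σ = 1 ∨ σ = -1 := by
    rcases Real.sign_apply_eq_of_ne_zero _ (sub_ne_zero.2 hlam) with h | h
    · exact Or.inr h
    · exact Or.inl h
  have hσ1 : σ * σ = 1 := by rcases hσ with h | h <;> rw [h] <;> norm_num
  have hσabs : σ * (lam - 1 / 2) = |lam - 1 / 2| := by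
    rcases lt_or_gt_of_ne (sub_ne_zero.2 hlam) with h | h
    · rw [hσdef, Real.sign_of_neg h, abs_of_neg h, neg_one_mul]
    · rw [hσdef, Real.sign_of_pos h, abs_of_pos h, one_mul]
  obtain ⟨b, K, c₁, hb, hc₁, hbad⟩ := hm.exists_tiltedMeasure_le o hσabs hσ1 hlam
  obtain ⟨p, s, hp, hp1, hs, hgood⟩ := hm.exists_pow_le_tiltedMeasure o lam hσ
  obtain ⟨c₀, hc₀, hrate⟩ := exists_rate (K := K) hb hp hp1
  obtain ⟨t, ht, hdist⟩ := hm.exists_abs_height_le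
  set c := min c₀ (min c₁ s) with hc
  have hcpos : 0 < c := lt_min hc₀ (lt_min hc₁ hs)
  have hheight : ∀ n : ℕ, 1 - ENNReal.ofReal (Real.exp (-c * n)) ≤
      tiltedMeasure Γ w o lam n {ω | c * n ≤ σ * Real.log (modular Γ o ω.last : ℝ)} := by
    intro n
    rcases hrate c (min_le_left _ _) n with h | h
    · rw [tsub_le_iff_right, ← hm.tiltedMeasure_add_compl o lam n
        {ω | c * n ≤ σ * Real.log (modular Γ o ω.last : ℝ)}]
      exact add_le_add_right ((hbad c ((min_le_right _ _).trans (min_le_left _ _)) n).trans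
        (ENNReal.ofReal_le_ofReal h)) _
    · rw [← ENNReal.ofReal_one, ← ENNReal.ofReal_sub _ (Real.exp_pos _).le]
      exact (ENNReal.ofReal_le_ofReal h).trans
        (hgood c ((min_le_right _ _).trans (min_le_right _ _)) n)
  have hc'pos : 0 < min c (c / t) := lt_min hcpos (div_pos hcpos ht)
  refine ⟨c, min c (c / t), hcpos, hc'pos, hheight, fun n => ?_⟩
  refine le_trans (tsub_le_tsub_left (ENNReal.ofReal_le_ofReal (Real.exp_le_exp.2 ?_)) _)
    ((hheight n).trans (MeasureTheory.measure_mono fun ω hω => ?_))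
  · exact mul_le_mul_of_nonneg_right (neg_le_neg (min_le_left _ _)) (Nat.cast_nonneg n)
  · have h1 : c * n ≤ σ * height Γ o ω.last := hω
    have h2 : σ * height Γ o ω.last ≤ |height Γ o ω.last| := by
      rcases hσ with h | h <;> rw [h]
      · rw [one_mul]
        exact le_abs_self _
      · rw [neg_one_mul]
        exact neg_le_abs _
    have h3 := hdist o ω.last
    have h4 : c / t * n ≤ G.dist o ω.last := by
      rw [div_mul_eq_mul_div, div_le_iff₀ ht]
      linarith
    exact (mul_le_mul_of_nonneg_right (min_le_right c (c / t)) (Nat.cast_nonneg n)).trans h4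

end IsNonunimodularModel

end MultiGraph

theorem theorem1p6 {V E : Type*} (G : MultiGraph V E) (hconn : G.IsConnected)
    (hfin : G.IsLocallyFinite) (Γ : Subgroup G.Aut) (htrans : MulAction.IsPretransitive Γ V)
    (hnonuni : ¬ MultiGraph.IsUnimodular Γ) (w : G.Path → ℝ≥0) (hw : MultiGraph.IsGood Γ w)
    (o : V) :
    -- (1) susceptibility and partition function
    (∀ lam : ℝ, lam ≠ 1 / 2 → ∃ C : ℝ≥0, 0 < C ∧
      (∀ z : ℝ≥0∞, 0 < z → z < MultiGraph.zCrit Γ w o lam →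
        MultiGraph.zCrit Γ w o lam / (MultiGraph.zCrit Γ w o lam - z)
            ≤ MultiGraph.susceptibility Γ w o z lam ∧
        MultiGraph.susceptibility Γ w o z lam
            ≤ C * (MultiGraph.zCrit Γ w o lam / (MultiGraph.zCrit Γ w o lam - z))) ∧
      (∀ n : ℕ, MultiGraph.muCrit Γ w o lam ^ n ≤ MultiGraph.partitionFn Γ w o lam n ∧
        MultiGraph.partitionFn Γ w o lam n ≤ C * MultiGraph.muCrit Γ w o lam ^ n)) ∧
    -- (2) exponential decay of the two-point function
    (∀ z : ℝ≥0∞, z < MultiGraph.zTilt Γ w o → ∃ C c : ℝ, 0 < C ∧ 0 < c ∧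
      ∀ x : V, MultiGraph.twoPoint w o z x
        ≤ ENNReal.ofReal (C * Real.exp (-c * (G.dist o x : ℝ)))) ∧
    -- (3) linear growth of the height and of the distance
    (∀ lam : ℝ, lam ≠ 1 / 2 → ∃ c c' : ℝ, 0 < c ∧ 0 < c' ∧
      (∀ n : ℕ, 1 - ENNReal.ofReal (Real.exp (-c * n)) ≤
        MultiGraph.tiltedMeasure Γ w o lam n
          {ω | c * n ≤ Real.sign (lam - 1 / 2) *
            Real.log (MultiGraph.modular Γ o ω.last : ℝ)}) ∧
      (∀ n : ℕ, 1 - ENNReal.ofReal (Real.exp (-c' * n)) ≤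
        MultiGraph.tiltedMeasure Γ w o lam n {ω | c' * n ≤ (G.dist o ω.last : ℝ)})) := by
  have hm : MultiGraph.IsNonunimodularModel Γ w := ⟨hconn, hfin, htrans, hnonuni, hw⟩
  exact ⟨fun _ hlam => hm.exists_mean_field o hlam, fun _ hz => hm.exists_twoPoint_le o hz,
    fun _ hlam => hm.exists_linear_growth o hlam⟩
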